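/- Let $0<a<r$ be coprime integers; write $\overline{s}^{\,t}$ for the least non-negative residue of $s$ modulo $t$. Let $N(r,a)=\mathbb Z^3+\mathbb Z\cdot\frac1r(1,a,r-a)$, let $M=\operatorname{Hom}(N(r,a),\mathbb Z)\subset\mathbb Z^3$, and put $p_i=\frac1r\bigl(\overline{-ib}^{\,r},\,r-i,\,i\bigr)$ for $0\le i\le r$, where $b$ is the inverse of $a$ modulo $r$ (so $p_0=e_2$, $p_r=e_3$, $p_{r-a}=\frac1r(1,a,r-a)$). The Danilov resolution $Y$ of the singularity $\frac1r(1,a,r-a)$ is the complex toric variety, for the lattice $N(r,a)$, whose fan is obtained from the octant $\langle e_1,e_2,e_3\rangle$ by subdividing it into $\langle e_2,e_3,p_{r-a}\rangle$, $\langle e_1,e_2,p_{r-a}\rangle$ and $\langle e_1,p_{r-a},e_3\rangle$, and then subdividing the second and the third of these cones recursively, as the octants (with $e_1,e_2,e_3$ corresponding to $e_1,e_2,p_{r-a}$, respectively $e_1,p_{r-a},e_3$) of the singularities $\frac1{r-a}\bigl(1,\overline{r}^{\,r-a},\overline{-r}^{\,r-a}\bigr)$ and $\frac1a\bigl(1,\overline{-r}^{\,a},\overline{r}^{\,a}\bigr)$;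 a singularity of index $1$ is smooth, and its octant is not subdivided. The rays of this fan are spanned by $e_1,p_0,\dots,p_r$; let $E_1,D_0,\dots,D_r$ be the corresponding torus-invariant prime divisors of $Y$. Let $\tau(r,a,\cdot)$ be the permutation of $\{0,\dots,r-1\}$ given by $\tau(r,a,i)=\overline{ai-1}^{\,r}$ if $a\in\{1,r-1\}$, and otherwise by $$\tau(r,a,i)=\begin{cases}\tau\bigl(r-a,\overline{r}^{\,r-a},\overline{i}^{\,r-a}\bigr)& i\ge a,\\ (r-a)+\tau\bigl(a,\overline{-r}^{\,a},i\bigr)& i<a.\end{cases}$$ With indices modulo $r$, and for $i=0,\dots,r-1$, put $Y_{i-a}=\sum_{k=0}^{\tau(r,a,i)}D_k$ and $Z_i=\sum_{k=\tau(r,a,i)+1}^{r}D_k$, and let the $X_i$ be the unique divisors with $X_0=E_1$ and $X_i+Z_{i+1}=Z_i+X_{i-a}$ for all $i$. The McKay quiver has vertices $\mathbb Z/r$ and arrows $x_i:i\to i+1$, $y_i:i\to i+a$, $z_i:i\to i-a$. A representation of it is an assignment of complex numbers to the arrows (that is, it has dimension vector $(1,\dots,1)$) satisfying $y_{i+1}x_i=x_{i+a}y_i$,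 $z_{i+1}x_i=x_{i-a}z_i$, $y_{i-a}z_i=z_{i+a}y_i$ for all $i$; two representations are isomorphic if they lie in one orbit of $(\mathbb C^*)^r$, where $g$ multiplies the number at an arrow $i\to j$ by $g_jg_i^{-1}$. Let $\mathcal F$ be the family of representations on $Y$ given by the line bundles $\mathcal O(X_i),\mathcal O(Y_i),\mathcal O(Z_i)$ with their natural sections. Its member $\mathcal F_s$ at a closed point $s\in Y$ is obtained as follows: choose a maximal cone $\sigma$ whose toric chart $U_\sigma=\operatorname{Spec}\mathbb C[\sigma^\vee\cap M]$ contains $s$, trivialise each of these line bundles on $U_\sigma$ by its monomial generator, and evaluate the natural sections at $s$. Then $\mathcal F_s$ is defined in every chart and is, up to isomorphism, independent of the chosen chart; and for any two distinct closed points $s\ne t$ of $Y$ the representations $\mathcal F_s$ and $\mathcal F_t$ are not isomorphic. -/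

import Mathlib

/-!
The Danilov resolution of the cyclic quotient singularity `(1/r)(1, a, r - a)`, as a toric variety
over `ℂ` (through its fan, its toric charts and its closed points), the toric line bundles `𝒪(D)`
on it, and the family of McKay quiver representations built from them.
-/

noncomputable section

namespace Danilov

/-- The least non-negative residue of `s` modulo `t`. -/
def residue (s : ℤ) (t : ℕ) : ℕ := (s % (t : ℤ)).toNat

/-! ### The lattices `N(r, a)` and `M(r, a)` -/

/-- The real vector space `N ⊗ ℝ`, with coordinates in the basis `e₁, e₂, e₃` of `N₀ = ℤ³`. -/
abbrev Vec : Type := Fin 3 → ℝ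

def e₁ : Vec := ![1, 0, 0]
def e₂ : Vec := ![0, 1, 0]
def e₃ : Vec := ![0, 0, 1]

/-- `N(r, a) = ℤ e₁ + ℤ e₂ + ℤ e₃ + ℤ (1/r)(e₁ + a e₂ + (r - a) e₃)`. -/
def latticeN (r a : ℕ) : AddSubgroup Vec :=
  AddSubgroup.closure {e₁, e₂, e₃, (1 / (r : ℝ)) • ![1, (a : ℝ), (r : ℝ) - (a : ℝ)]}

/-- The pairing of `M₀ = ℤ³` (exponents of Laurent monomials in three variables) with `N ⊗ ℝ`. -/
def pairing (m : Fin 3 → ℤ) (v : Vec) : ℝ := ∑ j, (m j : ℝ) * v j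

lemma pairing_zero (v : Vec) : pairing 0 v = 0 := by simp [pairing]

lemma pairing_add (m n : Fin 3 → ℤ) (v : Vec) :
    pairing (m + n) v = pairing m v + pairing n v := by
  simp [pairing, add_mul, Finset.sum_add_distrib]

lemma pairing_neg (m : Fin 3 → ℤ) (v : Vec) : pairing (-m) v = -pairing m v := by
  simp [pairing]

/-- `M(r, a) = Hom(N(r, a), ℤ)`, as the sublattice of `M₀ = Hom(N₀, ℤ)` of those functionals which
are integral on `N(r, a)`. -/
def latticeM (r a : ℕ) : AddSubgroup (Fin 3 → ℤ) where
  carrier := {m | ∀ v ∈ latticeN r a, ∃ k : ℤ, pairing m v = k}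
  zero_mem' := fun v _ => ⟨0, by simp [pairing_zero]⟩
  add_mem' := by
    intro m n hm hn v hv
    obtain ⟨k, hk⟩ := hm v hv
    obtain ⟨l, hl⟩ := hn v hv
    exact ⟨k + l, by rw [pairing_add, hk, hl]; push_cast; rfl⟩
  neg_mem' := by
    intro m hm v hv
    obtain ⟨k, hk⟩ := hm v hv
    exact ⟨-k, by rw [pairing_neg, hk]; push_cast; rfl⟩

/-! ### The fan of the Danilov resolution -/

/-- The lattice points `p_i = (1/r)(residue of -i b, r - i, i)`, `0 ≤ i ≤ r`, where `b` is the
inverse of `a` modulo `r`. -/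
def p (r a i : ℕ) : Vec :=
  (1 / (r : ℝ)) •
    ![(residue (-((i : ℤ) * (((a : ZMod r)⁻¹).val : ℤ))) r : ℝ), (r : ℝ) - (i : ℝ), (i : ℝ)]

/-- The cone spanned by three vectors. -/
def cone (u v w : Vec) : PointedCone ℝ Vec := PointedCone.hull ℝ {u, v, w}

/-- The linear map with `e₁ ↦ e₁`, `e₂ ↦ e₂`, `e₃ ↦ p_{r-a}`; it carries the lattice
`N(r - a, r mod (r - a))` onto `N(r, a)` and the octant onto `⟨e₁, e₂, p_{r-a}⟩`. -/
def mapL (r a : ℕ) : Vec →ₗ[ℝ] Vec := Fintype.linearCombination ℝ ![e₁, e₂, p r a (r - a)]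

/-- The linear map with `e₁ ↦ e₁`, `e₂ ↦ p_{r-a}`, `e₃ ↦ e₃`; it carries the lattice
`N(a, -r mod a)` onto `N(r, a)` and the octant onto `⟨e₁, p_{r-a}, e₃⟩`. -/
def mapR (r a : ℕ) : Vec →ₗ[ℝ] Vec := Fintype.linearCombination ℝ ![e₁, p r a (r - a), e₃]

/-- The three-dimensional cones of the fan of the Danilov resolution of `(1/r)(1, a, r - a)`.
The weighted blow-up of the octant in `p_{r-a}` subdivides it into `⟨e₂, e₃, p_{r-a}⟩`,
`⟨e₁, e₂, p_{r-a}⟩` and `⟨e₁, e₃, p_{r-a}⟩`; the first is smooth, and the other two are subdivided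
recursively, as the octants of the singularities `(1/(r-a))(1, r, -r)` and `(1/a)(1, -r, r)`.
The recursion ends at `r = 1`, where the octant is smooth and is not subdivided. -/
def maxCones (r a : ℕ) : Set (PointedCone ℝ Vec) :=
  if 0 < a ∧ a < r then
    {cone e₂ e₃ (p r a (r - a))}
      ∪ PointedCone.map (mapL r a) '' maxCones (r - a) (residue r (r - a))
      ∪ PointedCone.map (mapR r a) '' maxCones a (residue (-(r : ℤ)) a)
  else {cone e₁ e₂ e₃}
termination_by r
decreasing_by all_goals omega

/-! ### The toric charts and the closed points of the resolution -/

/-- The monoid `σ^∨ ∩ M(r, a)`. -/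
def dualMonoid (r a : ℕ) (σ : PointedCone ℝ Vec) : AddSubmonoid (latticeM r a) where
  carrier := {m | ∀ v ∈ σ, 0 ≤ pairing m v}
  zero_mem' := fun v _ => (pairing_zero v).ge
  add_mem' := by
    intro m n hm hn v hv
    have h := pairing_add (m : Fin 3 → ℤ) n v
    have h1 := hm v hv
    have h2 := hn v hv
    show 0 ≤ pairing ((m : Fin 3 → ℤ) + n) v
    linarith

lemma dualMonoid_anti (r a : ℕ) {σ τ : PointedCone ℝ Vec} (h : τ ≤ σ) :
    dualMonoid r a σ ≤ dualMonoid r a τ := fun _ hm v hv => hm v (h hv)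

/-- The coordinate ring `ℂ[σ^∨ ∩ M(r, a)]` of the toric chart `U_σ`. -/
abbrev CoordRing (r a : ℕ) (σ : PointedCone ℝ Vec) : Type :=
  AddMonoidAlgebra ℂ (dualMonoid r a σ)

/-- The closed points of `U_σ = Spec ℂ[σ^∨ ∩ M(r, a)]`: the `ℂ`-algebra homomorphisms from the
(finitely generated) coordinate ring to `ℂ`. -/
abbrev Pt (r a : ℕ) (σ : PointedCone ℝ Vec) : Type := CoordRing r a σ →ₐ[ℂ] ℂ

/-- For `τ ⊆ σ` the morphism `U_τ → U_σ` on closed points, given by the inclusion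
`ℂ[σ^∨ ∩ M] ⊆ ℂ[τ^∨ ∩ M]`. -/
def chartMap (r a : ℕ) {σ τ : PointedCone ℝ Vec} (h : τ ≤ σ) (w : Pt r a τ) : Pt r a σ :=
  w.comp (AddMonoidAlgebra.mapDomainAlgHom ℂ ℂ (AddSubmonoid.inclusion (dualMonoid_anti r a h)))

/-- A closed point of one of the charts `U_σ`, `σ` a maximal cone of the fan. -/
abbrev ChartPoint (r a : ℕ) : Type := (σ : maxCones r a) × Pt r a (σ : PointedCone ℝ Vec)

/-- The gluing of `U_σ` and `U_τ` along `U_{σ ∩ τ}`. -/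
def Glued (r a : ℕ) (s t : ChartPoint r a) : Prop :=
  ∃ w : Pt r a ((s.1 : PointedCone ℝ Vec) ⊓ (t.1 : PointedCone ℝ Vec)),
    chartMap r a inf_le_left w = s.2 ∧ chartMap r a inf_le_right w = t.2

/-- The set of closed points of the Danilov resolution: the charts `U_σ`, glued along the
`U_{σ ∩ τ}`. -/
def Resolution (r a : ℕ) : Type := Quot (Glued r a)

/-! ### The torus invariant divisors `X_i`, `Y_i`, `Z_i` -/

/-- Labels for the rays of the fan: `e₁` for the ray of `e₁`, and `p k` for the ray of `p_k`,
`k = 0, …, r` (recall `p_0 = e₂` and `p_r = e₃`). -/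
inductive Ray (r : ℕ) : Type
  | e₁ : Ray r
  | p : Fin (r + 1) → Ray r

/-- The generator of a ray. -/
def Ray.gen (r a : ℕ) : Ray r → Vec
  | .e₁ => Danilov.e₁
  | .p k => Danilov.p r a k

/-- Torus invariant divisors: the coefficient of the prime divisor of each ray (`E₁` for `e₁` and
`D_k` for `p_k`). -/
abbrev Divisor (r : ℕ) : Type := Ray r → ℤ

/-- The prime divisor `E₁`. -/
def divE₁ (r : ℕ) : Divisor r
  | .e₁ => 1
  | .p _ => 0

/-- The prime divisor `D_k`. -/
def divD (r k : ℕ) : Divisor r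
  | .e₁ => 0
  | .p l => if (l : ℕ) = k then 1 else 0

/-- The permutation `τ(r, a, ·)` of `{0, …, r - 1}`. -/
def tau (r a i : ℕ) : ℕ :=
  if 1 < a ∧ a < r - 1 then
    if a ≤ i then tau (r - a) (residue r (r - a)) (residue i (r - a))
    else (r - a) + tau a (residue (-(r : ℤ)) a) i
  else residue ((a : ℤ) * i - 1) r
termination_by r
decreasing_by all_goals omega

/-- `Y_{i-a} = D_0 + ⋯ + D_{τ(r,a,i)}`. -/
def divY (r a : ℕ) (j : ZMod r) : Divisor r :=
  ∑ k ∈ Finset.Icc 0 (tau r a (j + a).val), divD r k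

/-- `Z_i = D_{τ(r,a,i)+1} + ⋯ + D_r`. -/
def divZ (r a : ℕ) (i : ZMod r) : Divisor r :=
  ∑ k ∈ Finset.Icc (tau r a i.val + 1) r, divD r k

/-- The divisors `X_i`: the unique solution of `X_0 = E₁` and `X_i + Z_{i+1} = Z_i + X_{i-a}`
(see `divX_zero`, `divX_rec` and `divX_unique`), written out as
`X_{na} = E₁ + ∑_{l=1}^{n} (Z_{la} - Z_{la+1})` for `0 ≤ n < r`. -/
def divX (r a : ℕ) (i : ZMod r) : Divisor r :=
  divE₁ r + ∑ l ∈ Finset.range (i * (a : ZMod r)⁻¹).val,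
    (divZ r a (((l + 1 : ℕ) : ZMod r) * a) - divZ r a (((l + 1 : ℕ) : ZMod r) * a + 1))

lemma divX_zero (r a : ℕ) : divX r a 0 = divE₁ r := by
  simp [divX]

lemma sum_divZ_sub (r a : ℕ) (har : a < r) (hc : Nat.Coprime a r) :
    ∑ l ∈ Finset.range r,
      (divZ r a ((l : ZMod r) * a) - divZ r a ((l : ZMod r) * a + 1)) = 0 := by
  obtain ⟨n, rfl⟩ : ∃ n, r = n + 1 := ⟨r - 1, by omega⟩
  have hu : IsUnit (a : ZMod (n + 1)) := (ZMod.isUnit_iff_coprime a (n + 1)).2 hc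
  have h1 : Function.Bijective fun x : ZMod (n + 1) => x * (a : ZMod (n + 1)) :=
    hu.unit.mulRight_bijective
  have h2 : Function.Bijective fun x : ZMod (n + 1) => x * (a : ZMod (n + 1)) + 1 :=
    (Equiv.addRight (1 : ZMod (n + 1))).bijective.comp h1
  rw [Finset.sum_range
    (fun l => divZ (n + 1) a ((l : ZMod (n + 1)) * a) - divZ (n + 1) a ((l : ZMod (n + 1)) * a + 1))]
  have h3 : ∀ l : Fin (n + 1), (((l : ℕ) : ZMod (n + 1))) = (l : ZMod (n + 1)) :=
    fun l => ZMod.natCast_zmod_val (n := n + 1) l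
  simp only [h3]
  rw [Finset.sum_sub_distrib, sub_eq_zero]
  exact (h1.sum_comp (divZ (n + 1) a)).trans (h2.sum_comp (divZ (n + 1) a)).symm

lemma divX_rec (r a : ℕ) (har : a < r) (hc : Nat.Coprime a r) (i : ZMod r) :
    divX r a i + divZ r a (i + 1) = divZ r a i + divX r a (i - a) := by
  have : NeZero r := ⟨by omega⟩
  have hu : IsUnit (a : ZMod r) := (ZMod.isUnit_iff_coprime a r).2 hc
  have hia : i * (a : ZMod r)⁻¹ * a = i := by
    rw [mul_assoc, ZMod.inv_mul_of_unit _ hu, mul_one]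
  have hk : (i - a) * (a : ZMod r)⁻¹ = i * (a : ZMod r)⁻¹ - 1 := by
    rw [sub_mul, ZMod.mul_inv_of_unit _ hu]
  set j : ZMod r := i * (a : ZMod r)⁻¹ with hj
  obtain ⟨k, hkdef⟩ : ∃ k, k = (j - 1).val := ⟨_, rfl⟩
  have hkr : k < r := hkdef ▸ ZMod.val_lt _
  have hkj : ((k + 1 : ℕ) : ZMod r) = j := by
    rw [hkdef]; push_cast; rw [ZMod.natCast_zmod_val]; ring
  have key : divX r a i = (divZ r a i - divZ r a (i + 1)) + divX r a (i - a) := by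
    unfold divX
    rw [hk, ← hj, ← hkdef]
    rcases Nat.lt_or_ge (k + 1) r with h | h
    · have hv : j.val = k + 1 := by rw [← hkj, ZMod.val_cast_of_lt h]
      rw [hv, Finset.sum_range_succ, hkj, hia]
      abel
    · have hr : r = k + 1 := by omega
      have hj0 : j = 0 := by rw [← hkj, ← hr, ZMod.natCast_self]
      have hi0 : i = 0 := by rw [← hia, hj0, zero_mul]
      have hs := sum_divZ_sub r a har hc
      have hs' : ∑ l ∈ Finset.range (k + 1),
        (divZ r a ((l : ZMod r) * a) - divZ r a ((l : ZMod r) * a + 1)) = 0 := by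
        rwa [← hr]
      rw [Finset.sum_range_succ'] at hs'
      simp only [Nat.cast_zero, zero_mul] at hs'
      rw [hj0, hi0, ZMod.val_zero, Finset.sum_range_zero, add_left_comm, add_comm (divZ r a 0 - _),
        hs']
  rw [key]
  abel

lemma divX_unique (r a : ℕ) (har : a < r) (hc : Nat.Coprime a r)
    (X : ZMod r → Divisor r) (h0 : X 0 = divE₁ r)
    (h : ∀ i, X i + divZ r a (i + 1) = divZ r a i + X (i - a)) : X = divX r a := by
  have : NeZero r := ⟨by omega⟩
  have hu : IsUnit (a : ZMod r) := (ZMod.isUnit_iff_coprime a r).2 hc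
  have key : ∀ n : ℕ, X ((n : ZMod r) * a) = divX r a ((n : ZMod r) * a) := by
    intro n
    induction n with
    | zero => rw [Nat.cast_zero, zero_mul, h0, divX_zero]
    | succ n ih =>
      have e : (((n + 1 : ℕ) : ZMod r)) * a - a = (n : ZMod r) * a := by push_cast; ring
      have h1 := h (((n + 1 : ℕ) : ZMod r) * a)
      have h2 := divX_rec r a har hc (((n + 1 : ℕ) : ZMod r) * a)
      rw [e] at h1 h2
      rw [ih, ← h2] at h1
      exact add_right_cancel h1
  funext i
  have hia : i * (a : ZMod r)⁻¹ * a = i := by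
    rw [mul_assoc, ZMod.inv_mul_of_unit _ hu, mul_one]
  have h1 := key (i * (a : ZMod r)⁻¹).val
  rwa [ZMod.natCast_zmod_val, hia] at h1

/-! ### The line bundles `𝒪(D)` and their natural sections -/

/-- The ring `ℂ[M(r, a)]` of regular functions on the torus. -/
abbrev TorusRing (r a : ℕ) : Type := AddMonoidAlgebra ℂ (latticeM r a)

/-- The monomial `χ^m`. -/
def chi (r a : ℕ) (m : latticeM r a) : TorusRing r a := AddMonoidAlgebra.single m 1

/-- Restriction of regular functions from `U_σ` to the torus. -/
def toTorus (r a : ℕ) (σ : PointedCone ℝ Vec) : CoordRing r a σ →ₐ[ℂ] TorusRing r a :=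
  AddMonoidAlgebra.mapDomainAlgHom ℂ ℂ (dualMonoid r a σ).subtype

/-- The module `Γ(U_σ, 𝒪(D))` of rational functions `f` with `div f + D ≥ 0` on `U_σ`.  It is
spanned by the monomials `χ^m` in it, and `χ^m` has order `⟨m, u_ρ⟩` along the prime divisor of a
ray `ρ` with generator `u_ρ`; the rays which matter on `U_σ` are those contained in `σ`. -/
def sections (r a : ℕ) (σ : PointedCone ℝ Vec) (D : Divisor r) : Set (TorusRing r a) :=
  {f | ∀ m : latticeM r a, f.coeff m ≠ 0 →
    ∀ ρ : Ray r, ρ.gen r a ∈ σ → -(D ρ : ℝ) ≤ pairing m (ρ.gen r a)}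

/-- `χ^{-m}` is a frame of `𝒪(D)` on `U_σ`, i.e. `Γ(U_σ, 𝒪(D)) = ℂ[σ^∨ ∩ M] χ^{-m}`.  For given `σ`
and `D` there is exactly one such `m`; then `D` is the divisor of `χ^m` on `U_σ`. -/
def IsFrame (r a : ℕ) (σ : PointedCone ℝ Vec) (D : Divisor r) (m : latticeM r a) : Prop :=
  sections r a σ D = Set.range fun g : CoordRing r a σ => toTorus r a σ g * chi r a (-m)

/-- `c` is the value at `u ∈ U_σ` of the natural section `1` of `𝒪(D)`, in the monomial frame of
`𝒪(D)` on `U_σ`: the section is `1 = g χ^{-m}` with `g` regular on `U_σ`, and `c = g(u)`.  The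
monomial frames of `𝒪(D)` and `𝒪(D')` multiply to that of `𝒪(D + D')`. -/
def IsSectionValue (r a : ℕ) {σ : PointedCone ℝ Vec} (u : Pt r a σ) (D : Divisor r) (c : ℂ) :
    Prop :=
  ∃ (m : latticeM r a) (g : CoordRing r a σ),
    IsFrame r a σ D m ∧ toTorus r a σ g * chi r a (-m) = 1 ∧ u g = c

/-! ### The McKay quiver and the family of representations -/

/-- Representations of the McKay quiver of `(1/r)(1, a, r - a)`, with dimension vector `1`: the
vertices are the elements of `ℤ/r`, and there are arrows `x_i : i → i + 1`, `y_i : i → i + a` and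
`z_i : i → i - a`, each represented by a linear map `ℂ → ℂ`, i.e. a number, subject to the
commutativity relations. -/
structure McKayRep (r a : ℕ) where
  x : ZMod r → ℂ
  y : ZMod r → ℂ
  z : ZMod r → ℂ
  comm_xy : ∀ i, y (i + 1) * x i = x (i + a) * y i
  comm_xz : ∀ i, z (i + 1) * x i = x (i - a) * z i
  comm_yz : ∀ i, y (i - a) * z i = z (i + a) * y i

/-- Isomorphism of representations: being in one orbit of `GL(δ, ℂ) = (ℂˣ)^r`. -/
def McKayRep.Iso {r a : ℕ} (V W : McKayRep r a) : Prop :=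
  ∃ g : ZMod r → ℂˣ, ∀ i,
    W.x i = g (i + 1) * V.x i * ((g i)⁻¹ : ℂˣ) ∧
    W.y i = g (i + a) * V.y i * ((g i)⁻¹ : ℂˣ) ∧
    W.z i = g (i - a) * V.z i * ((g i)⁻¹ : ℂˣ)

/-- `V` is the representation cut out of the family `ℱ` (the line bundles `𝒪(X_i)`, `𝒪(Y_i)`,
`𝒪(Z_i)` with their natural sections) at a closed point of a chart, in the monomial frames of
that chart. -/
def IsFibreInChart {r a : ℕ} (u : ChartPoint r a) (V : McKayRep r a) : Prop :=
  ∀ i : ZMod r, IsSectionValue r a u.2 (divX r a i) (V.x i) ∧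
    IsSectionValue r a u.2 (divY r a i) (V.y i) ∧ IsSectionValue r a u.2 (divZ r a i) (V.z i)

/-- `V` is the representation `ℱ_s` at the closed point `s` of the Danilov resolution, computed in
any one of the charts that contain `s`. -/
def IsFibre {r a : ℕ} (s : Resolution r a) (V : McKayRep r a) : Prop :=
  ∃ u : ChartPoint r a, Quot.mk (Glued r a) u = s ∧ IsFibreInChart u V

end Danilov

end

/-!
The fan, the permutation `τ` and the family of representations are all governed by one recursion: a
weighted blow-up reduces `(r, a)` to `(r - a, r mod (r - a))` and `(a, -r mod a)`, ending at
`(1, 0)` (`blowup_induction`).  The McKay quiver follows it.  Along the rays of the octant of index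
`r - a` the arrows `z_l` with `l < a` have no zeros, and contracting them turns `ℤ/r` into
`ℤ/(r-a)`; along the rays of the octant of index `a` the same is true of the arrows `y_{l-a}` with
`l ≥ a`, and of `ℤ/a`.
This gives recursive formulas for the coefficients of the `Z_l` and `X_l` (`zCoef`, `xCoef`,
`divX_eq`), so in particular the `X_l` are effective.

*Existence.*  Each maximal cone is smooth (`Chart.exists_dual`), and the only rays of the fan in it
are its edges (`Chart.mem_of_rayVec`).  Hence in each chart `U_σ ≅ 𝔸³` every `𝒪(D)` has exactly one
monomial frame, and for effective `D` the natural section is a monomial in the coordinates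
(`ChartData.isSectionValue_iff_secVal`).  The relations of the quiver are equalities of divisors.

*Independence of the chart.*  In passing from one chart to another, the frame of `𝒪(D)` changes by a
transition function which is invertible on the overlap, because the cones form a fan
(`Chart.piecewise_linear`), is multiplicative in `D`, and is trivial for principal `D`.  The
divisors of the arrows are, up to principal divisors, the coboundary of the divisors
`X_0 + ⋯ + X_{l-1}` on the vertices (`exists_potential`, `xDiv_eq`, `zDiv_eq`), and the transition
functions of the latter are an isomorphism of the two representations (`iso_of_glued`).

*Injectivity.*  On one chart, the arrows without zeros connect the quiver (`Chart.connected`), so an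
isomorphism between two fibres is a constant, and the coordinates of the chart are values of arrows
(`Chart.exists_arrow`), so the two points agree (`eq_of_iso_of_chart`).  For points of two charts,
the set of vanishing arrows determines enough of the cone of the orbit through the first point to
show that this orbit lies in the second chart as well (`Chart.subset_of_vanishing`).  So both points
lie in the second chart (`glued_of_iso`), and the previous case applies.
-/

namespace Danilov

/-! ### Residues and the recursion on `(r, a)` -/

lemma residue_natCast (n t : ℕ) : residue (n : ℤ) t = n % t := by
  unfold residue; omega

lemma residue_lt (s : ℤ) {t : ℕ} (ht : 0 < t) : residue s t < t := by
  have h1 := Int.emod_nonneg s (show (t : ℤ) ≠ 0 by omega)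
  have h2 := Int.emod_lt_of_pos s (show (0 : ℤ) < t by omega)
  unfold residue; omega

lemma dvd_sub_residue (s : ℤ) {t : ℕ} (ht : 0 < t) : (t : ℤ) ∣ s - residue s t := by
  have h1 := Int.emod_nonneg s (show (t : ℤ) ≠ 0 by omega)
  have h2 : ((residue s t : ℕ) : ℤ) = s % t := by unfold residue; omega
  rw [h2]
  exact Int.dvd_self_sub_emod

lemma residue_eq_of_dvd {s : ℤ} {t n : ℕ} (hn : n < t) (h : (t : ℤ) ∣ s - n) :
    residue s t = n := by
  obtain ⟨q, hq⟩ := h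
  have h1 : s % t = (n : ℤ) % t := by
    rw [show s = n + t * q by linarith, Int.add_mul_emod_self_left]
  have h2 : (n : ℤ) % t = n := Int.emod_eq_of_lt (by omega) (by omega)
  unfold residue
  omega

lemma residue_neg_add_dvd (r : ℕ) {a : ℕ} (ha : 0 < a) : a ∣ residue (-(r : ℤ)) a + r := by
  have h := dvd_sub_residue (-(r : ℤ)) ha
  have h2 : (a : ℤ) ∣ ((residue (-(r : ℤ)) a + r : ℕ) : ℤ) := by
    have h3 : ((residue (-(r : ℤ)) a + r : ℕ) : ℤ) = -(-(r : ℤ) - residue (-(r : ℤ)) a) := by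
      push_cast; ring
    rw [h3]
    exact (dvd_neg).2 h
  exact_mod_cast h2

lemma coprime_left {r a : ℕ} (har : a < r) (hc : Nat.Coprime a r) :
    Nat.Coprime (residue (r : ℤ) (r - a)) (r - a) := by
  rw [residue_natCast]
  have h : Nat.Coprime r (r - a) := by
    rw [Nat.coprime_self_sub_right har.le]
    exact hc.symm
  unfold Nat.Coprime
  rw [← Nat.gcd_rec, Nat.gcd_comm]
  exact h

lemma coprime_right {r a : ℕ} (ha : 0 < a) (hc : Nat.Coprime a r) :
    Nat.Coprime (residue (-(r : ℤ)) a) a := by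
  obtain ⟨q, hq⟩ := residue_neg_add_dvd r ha
  refine Nat.Coprime.symm (Nat.coprime_of_dvd ?_)
  intro p hp hpa hpr
  have h1 : p ∣ r := by
    have : p ∣ residue (-(r : ℤ)) a + r := hq ▸ hpa.mul_right q
    exact (Nat.dvd_add_right hpr).1 this
  exact Nat.not_coprime_of_dvd_of_dvd hp.one_lt hpa h1 hc

/-- The induction along the recursive subdivision of the octant: a singularity of index `r > 1` is
reduced to the two singularities which remain after one weighted blow-up. -/
theorem blowup_induction {P : ℕ → ℕ → Prop} (smooth : P 1 0)
    (blowup : ∀ r a, 0 < a → a < r → Nat.Coprime a r → P (r - a) (residue (r : ℤ) (r - a)) →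
      P a (residue (-(r : ℤ)) a) → P r a) :
    ∀ r a, a < r → Nat.Coprime a r → P r a := by
  intro r
  induction r using Nat.strong_induction_on with
  | _ r ih =>
    intro a har hc
    rcases Nat.eq_zero_or_pos a with rfl | ha
    · have : r = 1 := by simpa using hc
      subst this
      exact smooth
    · exact blowup r a ha har hc
        (ih _ (by omega) _ (residue_lt _ (by omega)) (coprime_left har hc))
        (ih _ har _ (residue_lt _ ha) (coprime_right ha hc))

/-! ### The cyclic order of the vertices -/

/-- The vertex `l - a` of the McKay quiver, on least residues modulo `r`. -/
def back (r a l : ℕ) : ℕ := if a ≤ l then l - a else l + r - a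

/-- The vertex `l + 1` of the McKay quiver, on least residues modulo `r`. -/
def next (r l : ℕ) : ℕ := if l + 1 < r then l + 1 else 0

lemma back_lt {r a l : ℕ} (har : a ≤ r) (hl : l < r) : back r a l < r := by
  unfold back; split_ifs <;> omega

lemma next_lt {r l : ℕ} (hl : l < r) : next r l < r := by
  unfold next; split_ifs <;> omega

lemma next_eq_mod {r l : ℕ} (hl : l < r) : next r l = (l + 1) % r := by
  unfold next
  split_ifs with h
  · exact (Nat.mod_eq_of_lt h).symm
  · have : l + 1 = r := by omega
    rw [this, Nat.mod_self]

lemma back_eq_of_mod {r a l m : ℕ} (hm : m < r) (ha : a < r) (h : (m + a) % r = l) :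
    back r a l = m := by
  unfold back
  rcases Nat.lt_or_ge (m + a) r with h1 | h1
  · rw [Nat.mod_eq_of_lt h1] at h
    split_ifs <;> omega
  · have h2 : (m + a) % r = m + a - r := by
      rw [Nat.mod_eq_sub_mod h1, Nat.mod_eq_of_lt (by omega)]
    split_ifs <;> omega

lemma next_back {r a l : ℕ} (har : a < r) (hl : l < r) :
    next r (back r a l) = back r a (next r l) := by
  unfold next back; split_ifs <;> omega

/-- Modulo `r - a`, the step `l ↦ l - a` becomes the corresponding step for
`(1/(r-a))(1, r, -r)`. -/
lemma back_left {r a l : ℕ} (har : a < r) (hl : a ≤ l) :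
    back (r - a) (residue (r : ℤ) (r - a)) (l % (r - a)) = (l - a) % (r - a) := by
  have h0 : 0 < r - a := by omega
  refine back_eq_of_mod (Nat.mod_lt _ h0) (residue_lt _ h0) ?_
  rw [residue_natCast, ← Nat.add_mod]
  have : l - a + r = l + (r - a) := by omega
  rw [this, Nat.add_mod_right]

/-- Modulo `a`, the step `l ↦ l + r - a` becomes the corresponding step for
`(1/a)(1, -r, r)`. -/
lemma back_right {r a l : ℕ} (har : a < r) (hl : l < a) :
    back a (residue (-(r : ℤ)) a) l = (l + r - a) % a := by
  have h0 : 0 < a := by omega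
  refine back_eq_of_mod (Nat.mod_lt _ h0) (residue_lt _ h0) ?_
  obtain ⟨q, hq⟩ := residue_neg_add_dvd r h0
  have h1 : (l + r - a) % a = (l + r) % a := by
    rw [Nat.mod_eq_sub_mod (show a ≤ l + r by omega)]
  rw [h1, Nat.mod_add_mod]
  have : l + r + residue (-(r : ℤ)) a = l + a * q := by omega
  rw [this, Nat.add_mul_mod_self_left, Nat.mod_eq_of_lt hl]

/-! ### The permutation `τ` -/

lemma tau_one_zero (i : ℕ) : tau 1 0 i = 0 := by
  rw [tau]; simp [residue]

lemma tau_one_left {r i : ℕ} (hi : i < r) : tau r 1 i = if i = 0 then r - 1 else i - 1 := by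
  rw [tau]
  simp only [lt_irrefl, false_and, if_false]
  split_ifs with h
  · exact residue_eq_of_dvd (by omega) ⟨-1, by subst h; push_cast [show 1 ≤ r by omega]; ring⟩
  · exact residue_eq_of_dvd (by omega) ⟨0, by push_cast [show 1 ≤ i by omega]; ring⟩

lemma tau_pred {r i : ℕ} (hr : 1 < r) (hi : i < r) : tau r (r - 1) i = r - 1 - i := by
  rw [tau]
  simp only [lt_irrefl, and_false, if_false]
  exact residue_eq_of_dvd (by omega)
    ⟨i - 1, by push_cast [show 1 ≤ r by omega, show i ≤ r - 1 by omega]; ring⟩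

lemma tau_of_le {r a i : ℕ} (ha : 0 < a) (hai : a ≤ i) (hi : i < r) :
    tau r a i = tau (r - a) (residue (r : ℤ) (r - a)) (i % (r - a)) := by
  by_cases h : 1 < a ∧ a < r - 1
  · rw [tau, if_pos h, if_pos hai, residue_natCast i]
  · rcases (show a = 1 ∨ a = r - 1 by omega) with rfl | h1
    · rw [tau_one_left hi, residue_natCast]
      rcases (show r = 2 ∨ 2 < r by omega) with rfl | hr
      · rw [show (2 - 1 : ℕ) = 1 from rfl, Nat.mod_one, tau_one_zero]
        split_ifs <;> omega
      · have h2 : r % (r - 1) = 1 := by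
          rw [Nat.mod_eq_sub_mod (by omega), Nat.mod_eq_of_lt (by omega)]; omega
        rw [h2, tau_one_left (Nat.mod_lt _ (by omega))]
        rcases (show i = r - 1 ∨ i < r - 1 by omega) with h3 | h3
        · rw [h3, Nat.mod_self]; split_ifs <;> omega
        · rw [Nat.mod_eq_of_lt h3]; split_ifs <;> omega
    · have h3 : r - a = 1 := by omega
      rw [h3, Nat.mod_one, residue_natCast, Nat.mod_one, tau_one_zero, h1, tau_pred (by omega) hi]
      omega

lemma tau_of_lt {r a i : ℕ} (ha : 0 < a) (hia : i < a) (har : a < r) :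
    tau r a i = (r - a) + tau a (residue (-(r : ℤ)) a) i := by
  by_cases h : 1 < a ∧ a < r - 1
  · rw [tau, if_pos h, if_neg (by omega)]
  · have key : ∀ n : ℕ, 1 ≤ n → i < n → n < r →
        (1 : ℕ) = n ∨ n = r - 1 → tau r n i = (r - n) + tau n (residue (-(r : ℤ)) n) i := by
      rintro n hn hin hnr (rfl | h1)
      · have h0 : i = 0 := by omega
        have h2 : residue (-(r : ℤ)) 1 = 0 := residue_eq_of_dvd one_pos (by simp)
        rw [h2, tau_one_zero, tau_one_left (by omega), if_pos h0]; omega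
      · rcases (show r = 2 ∨ 2 < r by omega) with h3 | hr
        · subst h3; subst h1
          have h2 : residue (-((2 : ℕ) : ℤ)) (2 - 1) = 0 := residue_eq_of_dvd one_pos (by simp)
          rw [h2, show (2 - 1 : ℕ) = 1 from rfl, tau_one_zero, tau_one_left (by omega)]
          rw [if_pos (by omega)]
        · have h2 : residue (-(r : ℤ)) n = n - 1 := by
            refine residue_eq_of_dvd (by omega) ⟨-2, ?_⟩
            push_cast [hn]
            have : (r : ℤ) = n + 1 := by omega
            rw [this]; ring
          rw [h2, tau_pred (by omega) hin]
          rw [h1, tau_pred (by omega) (by omega)]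
          omega
    exact key a ha hia har (by omega)

lemma tau_lt {r a : ℕ} (har : a < r) (hc : Nat.Coprime a r) : ∀ i < r, tau r a i < r := by
  refine blowup_induction (P := fun r a => ∀ i < r, tau r a i < r) ?_ ?_ r a har hc
  · intro i _
    rw [tau_one_zero]; exact one_pos
  · intro r a ha har _ h1 h2 i hi
    rcases Nat.lt_or_ge i a with h | h
    · rw [tau_of_lt ha h har]
      have := h2 i h
      omega
    · rw [tau_of_le ha h hi]
      have := h1 (i % (r - a)) (Nat.mod_lt _ (by omega))
      omega

/-- Every residue class modulo `r - a` has a representative between `a` and `r - 1`. -/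
lemma exists_mod_eq {r a l : ℕ} (har : a < r) (hl : l < r - a) :
    ∃ i, a ≤ i ∧ i < r ∧ i % (r - a) = l := by
  have h0 : 0 < r - a := by omega
  refine ⟨a + (l + (r - a) - a % (r - a)) % (r - a), by omega, ?_, ?_⟩
  · have := Nat.mod_lt (l + (r - a) - a % (r - a)) h0
    omega
  · have h1 := Nat.mod_lt a h0
    rw [Nat.add_mod_mod, ← Nat.mod_add_mod a]
    have : a % (r - a) + (l + (r - a) - a % (r - a)) = l + (r - a) := by omega
    rw [this, Nat.add_mod_right, Nat.mod_eq_of_lt hl]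

lemma tau_surjective {r a : ℕ} (har : a < r) (hc : Nat.Coprime a r) :
    ∀ t < r, ∃ i < r, tau r a i = t := by
  refine blowup_induction (P := fun r a => ∀ t < r, ∃ i < r, tau r a i = t) ?_ ?_ r a har hc
  · intro t ht
    exact ⟨0, one_pos, by rw [tau_one_zero]; omega⟩
  · intro r a ha har _ h1 h2 t ht
    rcases Nat.lt_or_ge t (r - a) with h | h
    · obtain ⟨l, hl, hlt⟩ := h1 t h
      obtain ⟨i, hi1, hi2, hi3⟩ := exists_mod_eq har hl
      exact ⟨i, hi2, by rw [tau_of_le ha hi1 hi2, hi3, hlt]⟩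
    · obtain ⟨l, hl, hlt⟩ := h2 (t - (r - a)) (by omega)
      exact ⟨l, by omega, by rw [tau_of_lt ha hl har, hlt]; omega⟩

/-! ### The first coordinates of the points `p_k` -/

/-- `r` times the first coordinate of `p_k`. -/
def alpha (r a k : ℕ) : ℕ := residue (-((k : ℤ) * (((a : ZMod r)⁻¹).val : ℤ))) r

lemma alpha_lt {r a : ℕ} (har : a < r) (k : ℕ) : alpha r a k < r := residue_lt _ (by omega)

lemma dvd_mul_alpha_add {r a : ℕ} (har : a < r) (hc : Nat.Coprime a r) (k : ℕ) :
    r ∣ a * alpha r a k + k := by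
  have : NeZero r := ⟨by omega⟩
  have h := dvd_sub_residue (-((k : ℤ) * (((a : ZMod r)⁻¹).val : ℤ))) (show 0 < r by omega)
  have h1 := (ZMod.intCast_zmod_eq_zero_iff_dvd _ r).2 h
  push_cast at h1
  rw [ZMod.natCast_zmod_val] at h1
  have h2 : ((alpha r a k : ℕ) : ZMod r) = -(k * (a : ZMod r)⁻¹) := (sub_eq_zero.1 h1).symm
  rw [← ZMod.natCast_eq_zero_iff]
  push_cast
  rw [h2, mul_neg, mul_left_comm, ZMod.coe_mul_inv_eq_one a hc, mul_one, neg_add_cancel]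

lemma alpha_eq {r a k n : ℕ} (hc : Nat.Coprime a r) (hn : n < r)
    (h : r ∣ a * n + k) (har : a < r) : alpha r a k = n := by
  have h1 : a * alpha r a k ≡ a * n [MOD r] := by
    refine Nat.ModEq.add_right_cancel' k ?_
    exact ((Nat.modEq_zero_iff_dvd).2 (dvd_mul_alpha_add har hc k)).trans
      ((Nat.modEq_zero_iff_dvd).2 h).symm
  have h2 : alpha r a k ≡ n [MOD r] := Nat.ModEq.cancel_left_of_coprime hc.symm h1
  exact h2.eq_of_lt_of_lt (alpha_lt har k) hn

lemma alpha_zero {r a : ℕ} (har : a < r) (hc : Nat.Coprime a r) : alpha r a 0 = 0 :=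
  alpha_eq hc (by omega) (by simp) har

lemma alpha_self {r a : ℕ} (har : a < r) (hc : Nat.Coprime a r) : alpha r a r = 0 :=
  alpha_eq hc (by omega) (by simp) har

lemma eq_zero_or_eq_of_alpha_eq_zero {r a k : ℕ} (har : a < r) (hc : Nat.Coprime a r) (hk : k ≤ r)
    (h : alpha r a k = 0) : k = 0 ∨ k = r := by
  have h1 := dvd_mul_alpha_add har hc k
  rw [h, mul_zero, zero_add] at h1
  rcases Nat.eq_zero_or_pos k with h0 | h0
  · exact Or.inl h0
  · exact Or.inr (le_antisymm hk (Nat.le_of_dvd h0 h1))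

lemma alpha_left {r a k : ℕ} (ha : 0 < a) (har : a < r) (hc : Nat.Coprime a r) (hk : k ≤ r - a) :
    alpha r a k * (r - a) = alpha (r - a) (residue (r : ℤ) (r - a)) k * r + k := by
  have h0 : 0 < r - a := by omega
  set α' := alpha (r - a) (residue (r : ℤ) (r - a)) k with hα
  have hlt : α' < r - a := alpha_lt (residue_lt _ h0) k
  have h1 : r - a ∣ residue (r : ℤ) (r - a) * α' + k :=
    dvd_mul_alpha_add (residue_lt _ h0) (coprime_left har hc) k
  have h2 : r - a ∣ α' * r + k := by
    rw [residue_natCast] at h1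
    have : α' * r + k ≡ r % (r - a) * α' + k [MOD (r - a)] := by
      rw [mul_comm α' r]
      exact Nat.ModEq.add_right _ (Nat.ModEq.mul_right _ (Nat.mod_modEq r (r - a)).symm)
    exact (this.dvd_iff dvd_rfl).2 h1
  obtain ⟨q, hq⟩ := h2
  have hqr : q < r := by
    by_contra hcon
    have h3 : (r - a) * r ≤ (r - a) * q := Nat.mul_le_mul_left _ (by omega)
    have h4 : (α' + 1) * r ≤ (r - a) * r := Nat.mul_le_mul_right _ hlt
    rw [add_mul] at h4
    omega
  have h5 : r ∣ a * q + k := by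
    have h6 : (r : ℤ) ∣ ((a * q + k : ℕ) : ℤ) := by
      refine ⟨q - α', ?_⟩
      zify [har.le] at hq
      push_cast
      linear_combination hq
    exact_mod_cast h6
  rw [alpha_eq hc hqr h5 har, hq, mul_comm]

lemma alpha_right {r a k : ℕ} (ha : 0 < a) (har : a < r) (hc : Nat.Coprime a r) (hk : k ≤ a) :
    alpha r a (r - a + k) * a + k = alpha a (residue (-(r : ℤ)) a) k * r + a := by
  set α' := alpha a (residue (-(r : ℤ)) a) k with hα
  have hlt : α' < a := alpha_lt (residue_lt _ ha) k
  have h1 : a ∣ residue (-(r : ℤ)) a * α' + k :=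
    dvd_mul_alpha_add (residue_lt _ ha) (coprime_right ha hc) k
  obtain ⟨q1, hq1⟩ := h1
  obtain ⟨q2, hq2⟩ := residue_neg_add_dvd r ha
  obtain ⟨q, hq⟩ : ∃ q : ℕ, a * q + k = α' * r + a := by
    have h2 : (a : ℤ) ∣ ((α' * r + (a - k) : ℕ) : ℤ) := by
      refine ⟨q2 * α' - q1 + 1, ?_⟩
      zify at hq1 hq2
      push_cast [hk]
      linear_combination α' * hq2 - hq1
    obtain ⟨q, hq⟩ : a ∣ α' * r + (a - k) := by exact_mod_cast h2
    exact ⟨q, by omega⟩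
  have hqr : q < r := by
    by_contra hcon
    have h3 : a * r ≤ a * q := Nat.mul_le_mul_left _ (by omega)
    have h4 : (α' + 1) * r ≤ a * r := Nat.mul_le_mul_right _ hlt
    rw [add_mul] at h4
    omega
  have h5 : r ∣ a * q + (r - a + k) := by
    have h6 : (r : ℤ) ∣ ((a * q + (r - a + k) : ℕ) : ℤ) := by
      refine ⟨α' + 1, ?_⟩
      zify at hq
      push_cast [har.le]
      linear_combination hq
    exact_mod_cast h6
  rw [alpha_eq hc hqr h5 har, mul_comm, hq]

/-! ### The coefficients of the divisors -/

/-- The coefficient of `D_k` in `Z_l`; that in `Y_{l-a}` is `1 - zCoef r a l k`. -/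
def zCoef (r a l k : ℕ) : ℤ := if tau r a l < k then 1 else 0

/-- The coefficient of `D_k` in `X_l`, written down by recursion along the subdivision of the
octant.  For a ray of the octant of index `r - a`, the arrow `x_{r-1}` is the composite of an
`x`-arrow and a `z`-arrow of the smaller quiver; for a ray of the octant of index `a` it is the
composite of an `x`-arrow and a `y`-arrow. All other `x`-arrows come from `x`-arrows of the smaller
quiver. -/
def xCoef (r a l k : ℕ) : ℤ :=
  if 0 < a ∧ a < r then
    if k ≤ r - a then
      if l + 1 < r then xCoef (r - a) (residue (r : ℤ) (r - a)) (l % (r - a)) k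
      else xCoef (r - a) (residue (r : ℤ) (r - a)) (r - a - 1) k
        + zCoef (r - a) (residue (r : ℤ) (r - a)) (l % (r - a)) k
    else
      if l + 1 < r then xCoef a (residue (-(r : ℤ)) a) (l % a) (k - (r - a))
      else xCoef a (residue (-(r : ℤ)) a) (l % a) (k - (r - a))
        + (1 - zCoef a (residue (-(r : ℤ)) a) 0 (k - (r - a)))
  else 0
termination_by r
decreasing_by all_goals omega

lemma zCoef_nonneg (r a l k : ℕ) : 0 ≤ zCoef r a l k := by
  unfold zCoef; split_ifs <;> simp

lemma zCoef_le_one (r a l k : ℕ) : zCoef r a l k ≤ 1 := by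
  unfold zCoef; split_ifs <;> simp

lemma zCoef_zero (r a l : ℕ) : zCoef r a l 0 = 0 := by simp [zCoef]

lemma zCoef_self {r a l : ℕ} (har : a < r) (hc : Nat.Coprime a r) (hl : l < r) :
    zCoef r a l r = 1 := by simp [zCoef, tau_lt har hc l hl]

lemma zCoef_left {r a l k : ℕ} (ha : 0 < a) (hal : a ≤ l) (hl : l < r) :
    zCoef r a l k = zCoef (r - a) (residue (r : ℤ) (r - a)) (l % (r - a)) k := by
  rw [zCoef, zCoef, tau_of_le ha hal hl]

lemma zCoef_left_of_lt {r a l k : ℕ} (har : a < r) (hla : l < a) (hk : k ≤ r - a) :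
    zCoef r a l k = 0 := by
  rw [zCoef, tau_of_lt (by omega) hla har, if_neg (by omega)]

lemma zCoef_right {r a l k : ℕ} (har : a < r) (hla : l < a) :
    zCoef r a l (r - a + k) = zCoef a (residue (-(r : ℤ)) a) l k := by
  rw [zCoef, zCoef, tau_of_lt (by omega) hla har]
  simp

lemma zCoef_right_of_le {r a l k : ℕ} (ha : 0 < a) (hal : a ≤ l) (hl : l < r)
    (hc : Nat.Coprime a r) (hk : r - a ≤ k) : zCoef r a l k = 1 := by
  have h0 : 0 < r - a := by omega
  have := tau_lt (residue_lt (r : ℤ) h0) (coprime_left (by omega) hc) (l % (r - a))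
    (Nat.mod_lt _ h0)
  rw [zCoef, tau_of_le ha hal hl, if_pos (by omega)]

lemma xCoef_one_zero (l k : ℕ) : xCoef 1 0 l k = 0 := by
  rw [xCoef]; simp

lemma xCoef_nonneg (r a l k : ℕ) : 0 ≤ xCoef r a l k := by
  induction r using Nat.strong_induction_on generalizing a l k with
  | _ r ih =>
    rw [xCoef]
    split_ifs with h1 h2 h3 h3
    · exact ih _ (by omega) _ _ _
    · exact add_nonneg (ih _ (by omega) _ _ _) (zCoef_nonneg _ _ _ _)
    · exact ih _ (by omega) _ _ _
    · exact add_nonneg (ih _ (by omega) _ _ _) (sub_nonneg.2 (zCoef_le_one _ _ _ _))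
    · exact le_rfl

lemma xCoef_left {r a l k : ℕ} (ha : 0 < a) (har : a < r) (hl : l + 1 < r) (hk : k ≤ r - a) :
    xCoef r a l k = xCoef (r - a) (residue (r : ℤ) (r - a)) (l % (r - a)) k := by
  rw [xCoef, if_pos ⟨ha, har⟩, if_pos hk, if_pos hl]

lemma xCoef_left_last {r a k : ℕ} (ha : 0 < a) (har : a < r) (hk : k ≤ r - a) :
    xCoef r a (r - 1) k = xCoef (r - a) (residue (r : ℤ) (r - a)) (r - a - 1) k
      + zCoef (r - a) (residue (r : ℤ) (r - a)) ((r - 1) % (r - a)) k := by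
  rw [xCoef, if_pos ⟨ha, har⟩, if_pos hk, if_neg (by omega)]

/-- The divisors `X_l` do not contain the boundary components `D_0` and `D_r`. -/
lemma xCoef_boundary {r a : ℕ} (har : a < r) (hc : Nat.Coprime a r) :
    ∀ l < r, xCoef r a l 0 = 0 ∧ xCoef r a l r = 0 := by
  refine blowup_induction (P := fun r a => ∀ l < r, xCoef r a l 0 = 0 ∧ xCoef r a l r = 0)
    ?_ ?_ r a har hc
  · intro l _
    exact ⟨xCoef_one_zero _ _, xCoef_one_zero _ _⟩
  · intro r a ha har hc h1 h2 l hl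
    have h0 : 0 < r - a := by omega
    have h3 : r - (r - a) = a := by omega
    constructor
    · rw [xCoef, if_pos ⟨ha, har⟩, if_pos (Nat.zero_le _)]
      split_ifs
      · exact (h1 _ (Nat.mod_lt _ h0)).1
      · rw [(h1 _ (by omega)).1, zCoef_zero, add_zero]
    · rw [xCoef, if_pos ⟨ha, har⟩, if_neg (by omega), h3]
      split_ifs
      · exact (h2 _ (Nat.mod_lt _ ha)).2
      · rw [(h2 _ (Nat.mod_lt _ ha)).2, zCoef_self (residue_lt _ ha) (coprime_right ha hc) ha]
        norm_num

/-- The coefficient of `D_{r-a}` is defined through the octant of index `r - a`; the octant of index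
`a` gives the same value. -/
lemma xCoef_right {r a l k : ℕ} (ha : 0 < a) (har : a < r) (hc : Nat.Coprime a r)
    (hl : l + 1 < r) :
    xCoef r a l (r - a + k) = xCoef a (residue (-(r : ℤ)) a) (l % a) k := by
  rcases Nat.eq_zero_or_pos k with rfl | hk
  · have h0 : 0 < r - a := by omega
    rw [add_zero, xCoef_left ha har hl le_rfl,
      (xCoef_boundary (residue_lt _ h0) (coprime_left har hc) _ (Nat.mod_lt _ h0)).2,
      (xCoef_boundary (residue_lt _ ha) (coprime_right ha hc) _ (Nat.mod_lt _ ha)).1]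
  · rw [xCoef, if_pos ⟨ha, har⟩, if_neg (by omega), if_pos hl, Nat.add_sub_cancel_left]

lemma xCoef_right_last {r a k : ℕ} (ha : 0 < a) (har : a < r) (hc : Nat.Coprime a r) :
    xCoef r a (r - 1) (r - a + k) = xCoef a (residue (-(r : ℤ)) a) ((r - 1) % a) k
      + (1 - zCoef a (residue (-(r : ℤ)) a) 0 k) := by
  rcases Nat.eq_zero_or_pos k with rfl | hk
  · have h0 : 0 < r - a := by omega
    rw [add_zero, xCoef_left_last ha har le_rfl,
      (xCoef_boundary (residue_lt _ h0) (coprime_left har hc) _ (by omega)).2,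
      (xCoef_boundary (residue_lt _ ha) (coprime_right ha hc) _ (Nat.mod_lt _ ha)).1,
      zCoef_self (residue_lt _ h0) (coprime_left har hc) (Nat.mod_lt _ h0), zCoef_zero]
    norm_num
  · rw [xCoef, if_pos ⟨ha, har⟩, if_neg (by omega), if_neg (by omega), Nat.add_sub_cancel_left]

/-- For each ray `p_k` there is a function `t` on the vertices such that the divisors of an arrow
`x_l` and of an arrow `z_l` differ, along `D_k`, from the divisors of the functions `x` and `z` by
the coboundary of `t`.  So the divisors of the arrows in a cycle of the quiver add up to the divisor
of a monomial. -/
lemma exists_potential {r a : ℕ} (har : a < r) (hc : Nat.Coprime a r) : ∀ k ≤ r, ∃ t : ℕ → ℝ,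
    ∀ l < r, (zCoef r a l k : ℝ) = k / r + t l - t (back r a l) ∧
      (xCoef r a l k : ℝ) = alpha r a k / r + t l - t (next r l) := by
  refine blowup_induction (P := fun r a => ∀ k ≤ r, ∃ t : ℕ → ℝ,
    ∀ l < r, (zCoef r a l k : ℝ) = k / r + t l - t (back r a l) ∧
      (xCoef r a l k : ℝ) = alpha r a k / r + t l - t (next r l)) ?_ ?_ r a har hc
  · intro k hk
    refine ⟨fun _ => 0, fun l hl => ?_⟩
    have h1 : alpha 1 0 k = 0 := by
      have := alpha_lt (r := 1) (a := 0) one_pos k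
      omega
    rw [xCoef_one_zero, h1, zCoef, tau_one_zero]
    rcases (show k = 0 ∨ k = 1 by omega) with rfl | rfl <;> simp
  · intro r a ha har hc h1 h2 k hk
    have h0 : 0 < r - a := by omega
    have hr : (r : ℝ) ≠ 0 := by exact_mod_cast (show r ≠ 0 by omega)
    have ha' : (a : ℝ) ≠ 0 := by exact_mod_cast (show a ≠ 0 by omega)
    have hra : (r : ℝ) - a ≠ 0 := by
      have : ((r - a : ℕ) : ℝ) ≠ 0 := by exact_mod_cast (show r - a ≠ 0 by omega)
      rwa [Nat.cast_sub har.le] at this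
    rcases le_total k (r - a) with hk1 | hk1
    · obtain ⟨t, ht⟩ := h1 k hk1
      have hα : (alpha r a k : ℝ) * (r - a) =
          alpha (r - a) (residue (r : ℤ) (r - a)) k * r + k := by
        have := alpha_left ha har hc hk1
        rw [← Nat.cast_sub har.le]
        exact_mod_cast this
      have hα' : (alpha r a k : ℝ) / r =
          alpha (r - a) (residue (r : ℤ) (r - a)) k / (r - a) + k / (r * (r - a)) := by
        field_simp
        linear_combination hα
      refine ⟨fun l => t (l % (r - a)) + k / (r * (r - a)) * l, fun l hl => ⟨?_, ?_⟩⟩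
      · rcases Nat.lt_or_ge l a with hla | hla
        · have hm : (l + r - a) % (r - a) = l % (r - a) := by
            rw [show l + r - a = l + (r - a) by omega, Nat.add_mod_right]
          simp only [back, if_neg (show ¬ a ≤ l by omega), hm]
          rw [zCoef_left_of_lt har hla hk1, Nat.cast_sub (by omega)]
          push_cast
          field_simp
          ring
        · rw [zCoef_left ha hla hl, (ht _ (Nat.mod_lt _ h0)).1, back_left har hla]
          simp only [back, if_pos hla]
          rw [Nat.cast_sub hla, Nat.cast_sub har.le]
          field_simp
          ring
      · rcases (show l + 1 < r ∨ l = r - 1 by omega) with hl1 | rfl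
        · rw [xCoef_left ha har hl1 hk1, (ht _ (Nat.mod_lt _ h0)).2, hα',
            next_eq_mod (Nat.mod_lt _ h0), Nat.mod_add_mod]
          simp only [next, if_pos hl1]
          rw [Nat.cast_sub har.le]
          push_cast
          ring
        · have hb : back (r - a) (residue (r : ℤ) (r - a)) ((r - 1) % (r - a)) = r - a - 1 := by
            rw [back_left har (by omega), show r - 1 - a = r - a - 1 by omega,
              Nat.mod_eq_of_lt (by omega)]
          have hn : next (r - a) (r - a - 1) = 0 := by
            unfold next; rw [if_neg (by omega)]
          rw [xCoef_left_last ha har hk1]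
          push_cast
          rw [(ht _ (Nat.mod_lt _ h0)).1, (ht (r - a - 1) (by omega)).2, hb, hn, hα']
          simp only [next, if_neg (show ¬ (r - 1 + 1 < r) by omega), Nat.zero_mod]
          rw [Nat.cast_sub har.le, Nat.cast_sub (by omega)]
          push_cast
          field_simp
          ring
    · obtain ⟨k, rfl⟩ : ∃ j, k = r - a + j := ⟨k - (r - a), by omega⟩
      have hka : k ≤ a := by omega
      obtain ⟨t, ht⟩ := h2 k hka
      have hα : (alpha r a (r - a + k) : ℝ) * a + k =
          alpha a (residue (-(r : ℤ)) a) k * r + a := by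
        exact_mod_cast alpha_right ha har hc hka
      have hα' : (alpha r a (r - a + k) : ℝ) / r =
          alpha a (residue (-(r : ℤ)) a) k / a + (a - k) / (r * a) := by
        field_simp
        linear_combination hα
      refine ⟨fun l => t (l % a) + (a - k) / (r * a) * l, fun l hl => ⟨?_, ?_⟩⟩
      · rcases Nat.lt_or_ge l a with hla | hla
        · rw [zCoef_right har hla, (ht l hla).1, back_right har hla]
          simp only [back, if_neg (show ¬ a ≤ l by omega), Nat.mod_eq_of_lt hla]
          rw [Nat.cast_sub (by omega)]
          push_cast
          rw [Nat.cast_sub har.le]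
          field_simp
          ring
        · have hm : (l - a) % a = l % a := (Nat.mod_eq_sub_mod hla).symm
          rw [zCoef_right_of_le ha hla hl hc (by omega)]
          simp only [back, if_pos hla, hm]
          rw [Nat.cast_sub hla]
          push_cast
          rw [Nat.cast_sub har.le]
          field_simp
          ring
      · rcases (show l + 1 < r ∨ l = r - 1 by omega) with hl1 | rfl
        · rw [xCoef_right ha har hc hl1, (ht _ (Nat.mod_lt _ ha)).2, hα',
            next_eq_mod (Nat.mod_lt _ ha), Nat.mod_add_mod]
          simp only [next, if_pos hl1]
          push_cast
          ring
        · have hb : back a (residue (-(r : ℤ)) a) 0 = next a ((r - 1) % a) := by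
            rw [back_right har ha, next_eq_mod (Nat.mod_lt _ ha), Nat.mod_add_mod,
              show r - 1 + 1 = r by omega, zero_add, ← Nat.mod_eq_sub_mod har.le]
          rw [xCoef_right_last ha har hc]
          push_cast
          rw [(ht _ ha).1, (ht _ (Nat.mod_lt _ ha)).2, hb, hα']
          simp only [next, if_neg (show ¬ (r - 1 + 1 < r) by omega), Nat.zero_mod]
          rw [Nat.cast_sub (by omega)]
          push_cast
          field_simp
          ring

/-- The relation `X_l + Z_{l+1} = Z_l + X_{l-a}`, for the coefficients of `D_k`. -/
lemma xCoef_add_zCoef_next {r a k l : ℕ} (har : a < r) (hc : Nat.Coprime a r) (hk : k ≤ r)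
    (hl : l < r) :
    xCoef r a l k + zCoef r a (next r l) k = zCoef r a l k + xCoef r a (back r a l) k := by
  obtain ⟨t, ht⟩ := exists_potential har hc k hk
  have h : (xCoef r a l k + zCoef r a (next r l) k : ℝ) =
      zCoef r a l k + xCoef r a (back r a l) k := by
    rw [(ht l hl).1, (ht l hl).2, (ht _ (next_lt hl)).1, (ht _ (back_lt har.le hl)).2,
      next_back har hl]
    ring
  exact_mod_cast h

lemma xCoef_zero_left {r a : ℕ} (har : a < r) (hc : Nat.Coprime a r) : ∀ k ≤ r,
    xCoef r a 0 k = 0 := by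
  refine blowup_induction (P := fun r a => ∀ k ≤ r, xCoef r a 0 k = 0) ?_ ?_ r a har hc
  · intro k _
    exact xCoef_one_zero _ _
  · intro r a ha har hc h1 h2 k hk
    rcases le_total k (r - a) with hk1 | hk1
    · rw [xCoef_left ha har (by omega) hk1, Nat.zero_mod, h1 k hk1]
    · obtain ⟨k, rfl⟩ : ∃ j, k = r - a + j := ⟨k - (r - a), by omega⟩
      rw [xCoef_right ha har hc (by omega), Nat.zero_mod, h2 k (by omega)]

/-- Rays as elements of `Option ℕ`: the ray of `e₁` is `none`, and that of `p_k` is `some k`.  These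
labels do not depend on `r`, so the rays of the singularities in the recursion can be compared. -/
def Ray.label {r : ℕ} : Ray r → Option ℕ
  | .e₁ => none
  | .p k => some k

lemma Ray.label_injective (r : ℕ) : Function.Injective (Ray.label (r := r)) := by
  intro ρ ρ' h
  cases ρ <;> cases ρ' <;> simp_all [Ray.label, Fin.ext_iff]

lemma Ray.exists_label_eq {r : ℕ} {o : Option ℕ} (ho : ∀ k, o = some k → k ≤ r) :
    ∃ ρ : Ray r, ρ.label = o := by
  cases o with
  | none => exact ⟨.e₁, rfl⟩
  | some k => exact ⟨.p ⟨k, by have := ho k rfl; omega⟩, rfl⟩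

/-- The divisor `X_l` as a function of the labels of the rays. -/
def xDiv (r a l : ℕ) : Option ℕ → ℤ
  | none => 1
  | some k => xCoef r a l k

/-- The divisor `Y_{l-a}` as a function of the labels of the rays. -/
def yDiv (r a l : ℕ) : Option ℕ → ℤ
  | none => 0
  | some k => 1 - zCoef r a l k

/-- The divisor `Z_l` as a function of the labels of the rays. -/
def zDiv (r a l : ℕ) : Option ℕ → ℤ
  | none => 0
  | some k => zCoef r a l k

lemma xDiv_nonneg (r a l : ℕ) (o : Option ℕ) : 0 ≤ xDiv r a l o := by
  cases o with
  | none => exact zero_le_one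
  | some k => exact xCoef_nonneg r a l k

lemma yDiv_nonneg (r a l : ℕ) (o : Option ℕ) : 0 ≤ yDiv r a l o := by
  cases o with
  | none => exact le_rfl
  | some k => exact sub_nonneg.2 (zCoef_le_one r a l k)

lemma zDiv_nonneg (r a l : ℕ) (o : Option ℕ) : 0 ≤ zDiv r a l o := by
  cases o with
  | none => exact le_rfl
  | some k => exact zCoef_nonneg r a l k

lemma val_add_one {r : ℕ} (hr : 1 < r) (i : ZMod r) : (i + 1).val = next r i.val := by
  have : NeZero r := ⟨by omega⟩
  have : Fact (1 < r) := ⟨hr⟩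
  rw [next_eq_mod (ZMod.val_lt i), ZMod.val_add, ZMod.val_one]

lemma val_sub_natCast {r a : ℕ} (har : a < r) (i : ZMod r) :
    (i - a).val = back r a i.val := by
  have : NeZero r := ⟨by omega⟩
  refine (back_eq_of_mod (ZMod.val_lt _) har ?_).symm
  conv_rhs => rw [← sub_add_cancel i (a : ZMod r)]
  rw [ZMod.val_add, ZMod.val_natCast, Nat.mod_eq_of_lt har]

lemma sum_divD (r : ℕ) (S : Finset ℕ) (ρ : Ray r) :
    (∑ k ∈ S, divD r k) ρ = match ρ with
      | .e₁ => 0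
      | .p k => if (k : ℕ) ∈ S then 1 else 0 := by
  rw [Finset.sum_apply]
  cases ρ with
  | e₁ => simp [divD]
  | p k => simp [divD]

lemma divZ_eq {r a : ℕ} (i : ZMod r) (ρ : Ray r) : divZ r a i ρ = zDiv r a i.val ρ.label := by
  rw [divZ, sum_divD]
  cases ρ with
  | e₁ => rfl
  | p k =>
    simp only [Ray.label, zDiv, zCoef, Finset.mem_Icc]
    congr 1
    exact propext ⟨fun h => by omega, fun h => ⟨by omega, by omega⟩⟩

lemma divY_eq {r a : ℕ} (i : ZMod r) (ρ : Ray r) :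
    divY r a i ρ = yDiv r a (i + a).val ρ.label := by
  rw [divY, sum_divD]
  cases ρ with
  | e₁ => rfl
  | p k =>
    simp only [Ray.label, yDiv, zCoef, Finset.mem_Icc]
    split_ifs <;> first | rfl | omega

lemma divX_eq {r a : ℕ} (ha : 0 < a) (har : a < r) (hc : Nat.Coprime a r) (i : ZMod r)
    (ρ : Ray r) : divX r a i ρ = xDiv r a i.val ρ.label := by
  have hr : NeZero r := ⟨by omega⟩
  have h := divX_unique r a har hc (fun i ρ => xDiv r a i.val ρ.label) ?_ ?_
  · exact congrFun (congrFun h.symm i) ρ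
  · funext ρ
    cases ρ with
    | e₁ => rfl
    | p k =>
      simp only [Ray.label, xDiv, ZMod.val_zero, divE₁]
      exact xCoef_zero_left har hc k (by omega)
  · intro i
    funext ρ
    simp only [Pi.add_apply, divZ_eq]
    cases ρ with
    | e₁ => simp [Ray.label, xDiv, zDiv]
    | p k =>
      simp only [Ray.label, xDiv, zDiv]
      rw [val_add_one (by omega), val_sub_natCast har]
      exact xCoef_add_zCoef_next har hc (by omega) (ZMod.val_lt i)

/-! ### The maximal cones, by the labels of their rays -/

/-- The labels of the rays of the maximal cones of the fan. -/
inductive Chart : ℕ → ℕ → (Fin 3 → Option ℕ) → Prop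
  | octant : Chart 1 0 ![none, some 0, some 1]
  | top {r a : ℕ} (ha : 0 < a) (har : a < r) (hc : Nat.Coprime a r) :
      Chart r a ![some 0, some r, some (r - a)]
  | left {r a : ℕ} (ha : 0 < a) (har : a < r) (hc : Nat.Coprime a r) {s : Fin 3 → Option ℕ}
      (hs : Chart (r - a) (residue (r : ℤ) (r - a)) s) : Chart r a s
  | right {r a : ℕ} (ha : 0 < a) (har : a < r) (hc : Nat.Coprime a r) {s : Fin 3 → Option ℕ}
      (hs : Chart a (residue (-(r : ℤ)) a) s) :
      Chart r a (fun j => (s j).map (fun k => r - a + k))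

lemma Chart.lt {r a : ℕ} {s : Fin 3 → Option ℕ} (h : Chart r a s) : a < r := by
  cases h <;> omega

lemma Chart.coprime {r a : ℕ} {s : Fin 3 → Option ℕ} (h : Chart r a s) : Nat.Coprime a r := by
  cases h <;> first | assumption | simp

/-- A maximal cone is of the form `⟨e₁, p_k, p_{k+1}⟩`, or it is of the form `⟨p_i, p_k, p_j⟩` with
`i < j < k`. -/
lemma Chart.shape {r a : ℕ} {s : Fin 3 → Option ℕ} (h : Chart r a s) :
    (∃ k, k + 1 ≤ r ∧ s = ![none, some k, some (k + 1)]) ∨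
      ∃ i j k, i < j ∧ j < k ∧ k ≤ r ∧ s = ![some i, some k, some j] := by
  induction h with
  | octant => exact Or.inl ⟨0, le_rfl, rfl⟩
  | @top r a ha har hc => exact Or.inr ⟨0, r - a, r, by omega, by omega, le_rfl, rfl⟩
  | @left r a ha har hc s hs ih =>
    rcases ih with ⟨k, hk, rfl⟩ | ⟨i, j, k, hij, hjk, hk, rfl⟩
    · exact Or.inl ⟨k, by omega, rfl⟩
    · exact Or.inr ⟨i, j, k, hij, hjk, by omega, rfl⟩
  | @right r a ha har hc s hs ih =>
    rcases ih with ⟨k, hk, rfl⟩ | ⟨i, j, k, hij, hjk, hk, rfl⟩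
    · refine Or.inl ⟨r - a + k, by omega, ?_⟩
      funext j; fin_cases j <;> rfl
    · refine Or.inr ⟨r - a + i, r - a + j, r - a + k, by omega, by omega, by omega, ?_⟩
      funext j; fin_cases j <;> rfl

lemma Chart.le {r a : ℕ} {s : Fin 3 → Option ℕ} (h : Chart r a s) (j : Fin 3) {k : ℕ}
    (hk : s j = some k) : k ≤ r := by
  rcases h.shape with ⟨k', hk', rfl⟩ | ⟨i', j', k', hij, hjk, hk', rfl⟩ <;> fin_cases j <;>
    simp at hk <;> omega

/-- By the form of the maximal cones, `j` and `j'` are between `i` and `k` here: at most one maximal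
cone has the edges `p_i`, `p_k` and a third edge between them. -/
lemma Chart.middle_unique {r a : ℕ} (har : a < r) (hc : Nat.Coprime a r) : ∀ i j j' k : ℕ,
    i < k → Chart r a ![some i, some k, some j] → Chart r a ![some i, some k, some j'] →
      j = j' := by
  have hshift : ∀ {n i j k : ℕ} {s : Fin 3 → Option ℕ},
      (fun l => (s l).map (fun m => n + m)) = ![some i, some k, some j] →
      ∃ i' j' k', i = n + i' ∧ j = n + j' ∧ k = n + k' ∧ s = ![some i', some k', some j'] := by
    intro n i j k s hs
    have h0 := congrFun hs 0
    have h1 := congrFun hs 1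
    have h2 := congrFun hs 2
    simp only [Option.map_eq_some_iff, Matrix.cons_val_zero, Matrix.cons_val_one,
      Matrix.cons_val] at h0 h1 h2
    obtain ⟨i', hi, rfl⟩ := h0
    obtain ⟨k', hk, rfl⟩ := h1
    obtain ⟨j', hj, rfl⟩ := h2
    refine ⟨i', j', k', rfl, rfl, rfl, ?_⟩
    funext l; fin_cases l <;> assumption
  have hcases : ∀ {r a i j k : ℕ}, 0 < a → Chart r a ![some i, some k, some j] →
      (i = 0 ∧ k = r ∧ j = r - a) ∨
      (k ≤ r - a ∧ Chart (r - a) (residue (r : ℤ) (r - a)) ![some i, some k, some j]) ∨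
      ∃ i' j' k', i = r - a + i' ∧ j = r - a + j' ∧ k = r - a + k' ∧ k' ≤ a ∧
        Chart a (residue (-(r : ℤ)) a) ![some i', some k', some j'] := by
    intro r a i j k ha h
    generalize hs : ![some i, some k, some j] = s at h
    cases h with
    | octant => omega
    | top ha har hc =>
      have h0 := congrFun hs 0
      have h1 := congrFun hs 1
      have h2 := congrFun hs 2
      simp at h0 h1 h2
      exact Or.inl ⟨h0, h1, h2⟩
    | left ha har hc h =>
      subst hs
      exact Or.inr (Or.inl ⟨h.le 1 rfl, h⟩)
    | right ha har hc h =>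
      obtain ⟨i', j', k', hi, hj, hk, rfl⟩ := hshift hs.symm
      exact Or.inr (Or.inr ⟨i', j', k', hi, hj, hk, h.le 1 rfl, h⟩)
  refine blowup_induction (P := fun r a => ∀ i j j' k : ℕ, i < k →
    Chart r a ![some i, some k, some j] → Chart r a ![some i, some k, some j'] → j = j')
    ?_ ?_ r a har hc
  · intro i j j' k _ h
    rcases h.shape with ⟨k', hk', hs⟩ | ⟨i', j', k', hij, hjk, hk', hs⟩
    · exact absurd (congrFun hs 0) (by simp)
    · omega
  · intro r a ha har hc ih1 ih2 i j j' k hik h h'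
    rcases hcases ha h with ⟨hi, hk, hj⟩ | ⟨hk, h1⟩ | ⟨i1, j1, k1, hi1, hj1, hk1, hka, h1⟩ <;>
      rcases hcases ha h' with ⟨hi', hk', hj'⟩ | ⟨hk', h1'⟩ |
        ⟨i2, j2, k2, hi2, hj2, hk2, hka', h2⟩
    · omega
    · omega
    · omega
    · omega
    · exact ih1 _ _ _ _ hik h1 h1'
    · omega
    · omega
    · omega
    · have e1 : i2 = i1 := by omega
      have e2 : k2 = k1 := by omega
      subst e1; subst e2
      have := ih2 _ _ _ _ (by omega) h1 h2
      omega

/-! ### The arrows which are invertible on a chart -/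

lemma zDiv_left {r a l : ℕ} (ha : 0 < a) (hal : a ≤ l) (hl : l < r) (o : Option ℕ) :
    zDiv r a l o = zDiv (r - a) (residue (r : ℤ) (r - a)) (l % (r - a)) o := by
  cases o with
  | none => rfl
  | some k => exact zCoef_left ha hal hl

lemma yDiv_left {r a l : ℕ} (ha : 0 < a) (hal : a ≤ l) (hl : l < r) (o : Option ℕ) :
    yDiv r a l o = yDiv (r - a) (residue (r : ℤ) (r - a)) (l % (r - a)) o := by
  cases o with
  | none => rfl
  | some k => exact congrArg (fun z => 1 - z) (zCoef_left ha hal hl)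

lemma xDiv_left {r a l : ℕ} (ha : 0 < a) (har : a < r) (hl : l < r - a) {o : Option ℕ}
    (ho : ∀ k, o = some k → k ≤ r - a) :
    xDiv r a l o = xDiv (r - a) (residue (r : ℤ) (r - a)) l o := by
  cases o with
  | none => rfl
  | some k =>
    have h := xCoef_left ha har (show l + 1 < r by omega) (ho k rfl)
    rwa [Nat.mod_eq_of_lt hl] at h

lemma zDiv_left_of_lt {r a l : ℕ} (har : a < r) (hla : l < a) {o : Option ℕ}
    (ho : ∀ k, o = some k → k ≤ r - a) : zDiv r a l o = 0 := by
  cases o with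
  | none => rfl
  | some k => exact zCoef_left_of_lt har hla (ho k rfl)

lemma zDiv_right {r a l : ℕ} (har : a < r) (hla : l < a) (o : Option ℕ) :
    zDiv r a l (o.map fun k => r - a + k) = zDiv a (residue (-(r : ℤ)) a) l o := by
  cases o with
  | none => rfl
  | some k => exact zCoef_right har hla

lemma yDiv_right {r a l : ℕ} (har : a < r) (hla : l < a) (o : Option ℕ) :
    yDiv r a l (o.map fun k => r - a + k) = yDiv a (residue (-(r : ℤ)) a) l o := by
  cases o with
  | none => rfl
  | some k => exact congrArg (fun z => 1 - z) (zCoef_right har hla)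

lemma xDiv_right {r a l : ℕ} (har : a < r) (hc : Nat.Coprime a r) (hla : l < a) (o : Option ℕ) :
    xDiv r a l (o.map fun k => r - a + k) = xDiv a (residue (-(r : ℤ)) a) l o := by
  cases o with
  | none => rfl
  | some k =>
    have h := xCoef_right (k := k) (show 0 < a by omega) har hc (show l + 1 < r by omega)
    rwa [Nat.mod_eq_of_lt hla] at h

lemma yDiv_right_of_le {r a l : ℕ} (ha : 0 < a) (hal : a ≤ l) (hl : l < r)
    (hc : Nat.Coprime a r) (o : Option ℕ) : yDiv r a l (o.map fun k => r - a + k) = 0 := by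
  cases o with
  | none => rfl
  | some k => exact sub_eq_zero.2 (zCoef_right_of_le ha hal hl hc (Nat.le_add_right _ _)).symm

lemma zCoef_top {r a l : ℕ} (ha : 0 < a) (har : a < r) (hc : Nat.Coprime a r) (hl : l < r) :
    zCoef r a l (r - a) = if a ≤ l then 1 else 0 := by
  split_ifs with h
  · exact zCoef_right_of_le ha h hl hc le_rfl
  · exact zCoef_left_of_lt har (by omega) le_rfl

lemma xCoef_top {r a l : ℕ} (ha : 0 < a) (har : a < r) (hc : Nat.Coprime a r) (hl : l < r) :
    xCoef r a l (r - a) = if l + 1 < r then 0 else 1 := by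
  have h0 : 0 < r - a := by omega
  split_ifs with h
  · rw [xCoef_left ha har h le_rfl,
      (xCoef_boundary (residue_lt _ h0) (coprime_left har hc) _ (Nat.mod_lt _ h0)).2]
  · obtain rfl : l = r - 1 := by omega
    rw [xCoef_left_last ha har le_rfl,
      (xCoef_boundary (residue_lt _ h0) (coprime_left har hc) _ (by omega)).2,
      zCoef_self (residue_lt _ h0) (coprime_left har hc) (Nat.mod_lt _ h0), zero_add]

/-- On each chart, the arrows whose natural sections do not vanish anywhere connect all vertices of
the quiver. -/
lemma Chart.connected {r a : ℕ} {s : Fin 3 → Option ℕ} (h : Chart r a s) {β : Type*} :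
    ∀ g : ℕ → β, (∀ l < r, (∀ j, zDiv r a l (s j) = 0) → g (back r a l) = g l) →
      (∀ l < r, (∀ j, yDiv r a l (s j) = 0) → g (back r a l) = g l) →
      (∀ l < r, (∀ j, xDiv r a l (s j) = 0) → g (next r l) = g l) → ∀ l < r, g l = g 0 := by
  induction h with
  | octant =>
    intro g _ _ _ l hl
    rw [show l = 0 by omega]
  | @top r a ha har hc =>
    intro g _ _ hX l
    induction l with
    | zero => intro _; rfl
    | succ l ih =>
      intro hl
      have h1 := hX l (by omega) ?_
      · rw [next, if_pos hl] at h1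
        rw [h1, ih (by omega)]
      · intro j
        fin_cases j
        · exact (xCoef_boundary har hc l (by omega)).1
        · exact (xCoef_boundary har hc l (by omega)).2
        · exact (xCoef_top ha har hc (by omega)).trans (if_pos hl)
  | @left r a ha har hc s hs ih =>
    intro g hZ hY hX
    have hle := hs.le
    have hmod : ∀ l < r, g l = g (l % (r - a)) := by
      intro l
      -- for `l < a` the arrow `z_l` ends at `l + (r - a)`, and it is invertible on the chart
      induction l using Nat.strong_induction_on with
      | _ l ihl =>
        intro hl
        rcases Nat.lt_or_ge l (r - a) with h1 | h1
        · rw [Nat.mod_eq_of_lt h1]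
        · have h2 := hZ (l - (r - a)) (by omega)
            (fun j => zDiv_left_of_lt har (by omega) (fun k hk => hle j hk))
          rw [back, if_neg (by omega), show l - (r - a) + r - a = l by omega] at h2
          rw [h2, ihl _ (by omega) (by omega), ← Nat.mod_eq_sub_mod h1]
    have key := ih g ?_ ?_ ?_
    · intro l hl
      rw [hmod l hl, key _ (Nat.mod_lt _ (by omega))]
    · intro l hl hz
      obtain ⟨i, hi1, hi2, rfl⟩ := exists_mod_eq har hl
      have := hZ i hi2 (fun j => by rw [zDiv_left ha hi1 hi2, hz j])
      rw [back, if_pos hi1] at this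
      rw [back_left har hi1, ← hmod _ (by omega), ← hmod _ hi2, this]
    · intro l hl hy
      obtain ⟨i, hi1, hi2, rfl⟩ := exists_mod_eq har hl
      have := hY i hi2 (fun j => by rw [yDiv_left ha hi1 hi2, hy j])
      rw [back, if_pos hi1] at this
      rw [back_left har hi1, ← hmod _ (by omega), ← hmod _ hi2, this]
    · intro l hl hx
      have := hX l (by omega) (fun j => by rw [xDiv_left ha har hl (fun k hk => hle j hk), hx j])
      rw [next, if_pos (by omega)] at this
      rw [next_eq_mod hl, ← hmod _ (by omega), this]
  | @right r a ha har hc s hs ih =>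
    intro g hZ hY hX
    have hmod : ∀ l < r, g l = g (l % a) := by
      intro l
      induction l using Nat.strong_induction_on with
      | _ l ihl =>
        intro hl
        rcases Nat.lt_or_ge l a with h1 | h1
        · rw [Nat.mod_eq_of_lt h1]
        · have h2 := hY l hl (fun j => yDiv_right_of_le ha h1 hl hc (s j))
          rw [back, if_pos h1] at h2
          rw [← h2, ihl _ (by omega) (by omega), ← Nat.mod_eq_sub_mod h1]
    have key := ih g ?_ ?_ ?_
    · intro l hl
      rw [hmod l hl, key _ (Nat.mod_lt _ ha)]
    · intro l hl hz
      have := hZ l (by omega) (fun j => by rw [zDiv_right har hl, hz j])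
      rw [back, if_neg (by omega)] at this
      rw [back_right har hl, ← hmod _ (by omega), this]
    · intro l hl hy
      have := hY l (by omega) (fun j => by rw [yDiv_right har hl, hy j])
      rw [back, if_neg (by omega)] at this
      rw [back_right har hl, ← hmod _ (by omega), this]
    · intro l hl hx
      have := hX l (by omega) (fun j => by rw [xDiv_right har hc hl, hx j])
      rw [next, if_pos (by omega)] at this
      rw [next_eq_mod hl, ← hmod _ (by omega), this]

/-- Each coordinate of a chart is the natural section of an arrow. -/
lemma Chart.exists_arrow {r a : ℕ} {s : Fin 3 → Option ℕ} (h : Chart r a s) :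
    ∀ j, ∃ l < r, (∀ i, xDiv r a l (s i) = if i = j then 1 else 0) ∨
      (∀ i, yDiv r a l (s i) = if i = j then 1 else 0) ∨
      (∀ i, zDiv r a l (s i) = if i = j then 1 else 0) := by
  induction h with
  | octant =>
    intro j
    refine ⟨0, one_pos, ?_⟩
    fin_cases j
    · left
      intro i
      fin_cases i <;> simp [xDiv, xCoef_one_zero]
    · right; left
      intro i
      fin_cases i <;> simp [yDiv, zCoef, tau_one_zero]
    · right; right
      intro i
      fin_cases i <;> simp [zDiv, zCoef, tau_one_zero]
  | @top r a ha har hc =>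
    intro j
    fin_cases j
    · refine ⟨a, har, Or.inr (Or.inl ?_)⟩
      intro i
      fin_cases i <;>
        simp [yDiv, zCoef_zero, zCoef_self har hc har, zCoef_top ha har hc har]
    · refine ⟨0, by omega, Or.inr (Or.inr ?_)⟩
      intro i
      fin_cases i <;> simp [zDiv, zCoef_zero, zCoef_self har hc (show 0 < r by omega),
        zCoef_top ha har hc (show 0 < r by omega)]
      omega
    · refine ⟨r - 1, by omega, Or.inl ?_⟩
      have hb := xCoef_boundary har hc (r - 1) (by omega)
      intro i
      fin_cases i <;> simp [xDiv, hb.1, hb.2, xCoef_top ha har hc (show r - 1 < r by omega)]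
      omega
  | @left r a ha har hc s hs ih =>
    intro j
    obtain ⟨l, hl, h | h | h⟩ := ih j
    · exact ⟨l, by omega, Or.inl fun i => by
        rw [xDiv_left ha har hl (fun k hk => hs.le i hk), h i]⟩
    · obtain ⟨i, hi1, hi2, rfl⟩ := exists_mod_eq har hl
      exact ⟨i, hi2, Or.inr (Or.inl fun j => by rw [yDiv_left ha hi1 hi2, h j])⟩
    · obtain ⟨i, hi1, hi2, rfl⟩ := exists_mod_eq har hl
      exact ⟨i, hi2, Or.inr (Or.inr fun j => by rw [zDiv_left ha hi1 hi2, h j])⟩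
  | @right r a ha har hc s hs ih =>
    intro j
    obtain ⟨l, hl, h | h | h⟩ := ih j
    · exact ⟨l, by omega, Or.inl fun i => by rw [xDiv_right har hc hl, h i]⟩
    · exact ⟨l, by omega, Or.inr (Or.inl fun i => by rw [yDiv_right har hl, h i])⟩
    · exact ⟨l, by omega, Or.inr (Or.inr fun i => by rw [zDiv_right har hl, h i])⟩

/-! ### The vectors spanning the rays -/

/-- The generator of the ray with a given label. -/
noncomputable def rayVec (r a : ℕ) : Option ℕ → Vec
  | none => e₁
  | some k => p r a k

lemma Ray.gen_eq {r a : ℕ} (ρ : Ray r) : ρ.gen r a = rayVec r a ρ.label := by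
  cases ρ <;> rfl

lemma p_apply_zero (r a k : ℕ) : p r a k 0 = alpha r a k / r := by
  simp [p, alpha, div_eq_inv_mul]

lemma p_apply_one (r a k : ℕ) : p r a k 1 = ((r : ℝ) - k) / r := by
  simp [p, div_eq_inv_mul]

lemma p_apply_two (r a k : ℕ) : p r a k 2 = (k : ℝ) / r := by
  simp [p, div_eq_inv_mul]

lemma alpha_top {r a : ℕ} (ha : 0 < a) (har : a < r) (hc : Nat.Coprime a r) :
    alpha r a (r - a) = 1 :=
  alpha_eq hc (by omega) ⟨1, by omega⟩ har

lemma mapL_apply {r a : ℕ} (ha : 0 < a) (har : a < r) (hc : Nat.Coprime a r) (v : Vec) :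
    mapL r a v = ![v 0 + v 2 / r, v 1 + v 2 * a / r, v 2 * ((r : ℝ) - a) / r] := by
  funext i
  simp only [mapL, Fintype.linearCombination_apply, Fin.sum_univ_three]
  fin_cases i <;>
    simp [e₁, e₂, p_apply_zero, p_apply_one, p_apply_two, alpha_top ha har hc,
      Nat.cast_sub har.le, div_eq_mul_inv, mul_assoc]

lemma mapR_apply {r a : ℕ} (ha : 0 < a) (har : a < r) (hc : Nat.Coprime a r) (v : Vec) :
    mapR r a v = ![v 0 + v 1 / r, v 1 * a / r, v 1 * ((r : ℝ) - a) / r + v 2] := by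
  funext i
  simp only [mapR, Fintype.linearCombination_apply, Fin.sum_univ_three]
  fin_cases i <;>
    simp [Matrix.vecHead, Matrix.vecTail, e₁, e₃, p_apply_zero, p_apply_one, p_apply_two,
      alpha_top ha har hc,
      Nat.cast_sub har.le, div_eq_mul_inv, mul_assoc]

lemma mapL_rayVec {r a : ℕ} (ha : 0 < a) (har : a < r) (hc : Nat.Coprime a r) {o : Option ℕ}
    (ho : ∀ k, o = some k → k ≤ r - a) :
    mapL r a (rayVec (r - a) (residue (r : ℤ) (r - a)) o) = rayVec r a o := by
  rw [mapL_apply ha har hc]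
  have hr : (r : ℝ) ≠ 0 := by exact_mod_cast (show r ≠ 0 by omega)
  have hra : (r : ℝ) - a ≠ 0 := by
    have : ((r - a : ℕ) : ℝ) ≠ 0 := by exact_mod_cast (show r - a ≠ 0 by omega)
    rwa [Nat.cast_sub har.le] at this
  cases o with
  | none =>
    funext i
    fin_cases i <;> simp [rayVec, e₁]
  | some k =>
    have hα : (alpha r a k : ℝ) * (r - a) =
        alpha (r - a) (residue (r : ℤ) (r - a)) k * r + k := by
      have := alpha_left ha har hc (ho k rfl)
      rw [← Nat.cast_sub har.le]
      exact_mod_cast this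
    simp only [rayVec, p_apply_zero, p_apply_one, p_apply_two, Nat.cast_sub har.le]
    funext i
    fin_cases i
    · simp only [Fin.zero_eta, Matrix.cons_val_zero, p_apply_zero]
      field_simp
      linear_combination -hα
    · simp only [Fin.mk_one, Matrix.cons_val_one, Matrix.cons_val_zero, p_apply_one]
      field_simp
      ring
    · simp only [Fin.reduceFinMk, Matrix.cons_val, p_apply_two]
      field_simp

lemma mapR_rayVec {r a : ℕ} (ha : 0 < a) (har : a < r) (hc : Nat.Coprime a r) {o : Option ℕ}
    (ho : ∀ k, o = some k → k ≤ a) :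
    mapR r a (rayVec a (residue (-(r : ℤ)) a) o) =
      rayVec r a (o.map fun k => r - a + k) := by
  rw [mapR_apply ha har hc]
  have hr : (r : ℝ) ≠ 0 := by exact_mod_cast (show r ≠ 0 by omega)
  have ha' : (a : ℝ) ≠ 0 := by exact_mod_cast (show a ≠ 0 by omega)
  cases o with
  | none =>
    funext i
    fin_cases i <;> simp [rayVec, e₁]
  | some k =>
    have hα : (alpha r a (r - a + k) : ℝ) * a + k =
        alpha a (residue (-(r : ℤ)) a) k * r + a := by
      exact_mod_cast alpha_right ha har hc (ho k rfl)
    simp only [rayVec, p_apply_zero, p_apply_one, p_apply_two, Option.map_some]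
    funext i
    fin_cases i
    · simp only [Fin.zero_eta, Matrix.cons_val_zero, p_apply_zero]
      field_simp
      linear_combination -hα
    · simp only [Fin.mk_one, Matrix.cons_val_one, Matrix.cons_val_zero, p_apply_one]
      push_cast [Nat.cast_sub har.le]
      field_simp
      ring
    · simp only [Fin.reduceFinMk, Matrix.cons_val, p_apply_two]
      push_cast [Nat.cast_sub har.le]
      field_simp
      ring

lemma rayVec_nonneg (r a : ℕ) {o : Option ℕ} (ho : ∀ k, o = some k → k ≤ r) (i : Fin 3) :
    0 ≤ rayVec r a o i := by
  cases o with
  | none => fin_cases i <;> simp [rayVec, e₁]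
  | some k =>
    have h : (0 : ℝ) ≤ r - k := sub_nonneg.2 (by exact_mod_cast ho k rfl)
    fin_cases i
    · exact (div_nonneg (Nat.cast_nonneg _) (Nat.cast_nonneg _)).trans_eq (p_apply_zero r a k).symm
    · exact (div_nonneg h (Nat.cast_nonneg _)).trans_eq (p_apply_one r a k).symm
    · exact (div_nonneg (Nat.cast_nonneg _) (Nat.cast_nonneg _)).trans_eq (p_apply_two r a k).symm

/-! ### The lattice `M` and the smoothness of the charts -/

lemma pairing_eq (m : Fin 3 → ℤ) (v : Vec) :
    pairing m v = m 0 * v 0 + m 1 * v 1 + m 2 * v 2 := by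
  simp [pairing, Fin.sum_univ_three]

lemma pairing_sum_smul (m : Fin 3 → ℤ) (c : Fin 3 → ℝ) (u : Fin 3 → Vec) :
    pairing m (∑ j, c j • u j) = ∑ j, c j * pairing m (u j) := by
  simp only [pairing_eq, Fin.sum_univ_three, Pi.add_apply, Pi.smul_apply, smul_eq_mul]
  ring

lemma mem_latticeM_iff {r a : ℕ} (hr : 0 < r) (m : Fin 3 → ℤ) :
    m ∈ latticeM r a ↔ (r : ℤ) ∣ m 0 + a * m 1 + (r - a) * m 2 := by
  have hr' : (r : ℝ) ≠ 0 := by exact_mod_cast hr.ne'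
  constructor
  · intro h
    obtain ⟨k, hk⟩ := h ((1 / (r : ℝ)) • ![1, (a : ℝ), (r : ℝ) - (a : ℝ)])
      (AddSubgroup.subset_closure (by simp))
    refine ⟨k, ?_⟩
    rw [pairing_eq] at hk
    simp at hk
    field_simp at hk
    have : ((m 0 + a * m 1 + (r - a) * m 2 : ℤ) : ℝ) = ((r * k : ℤ) : ℝ) := by
      push_cast
      linear_combination hk
    exact_mod_cast this
  · rintro ⟨q, hq⟩ v hv
    have hq' : (m 0 : ℝ) + a * m 1 + (r - a) * m 2 = r * q := by exact_mod_cast hq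
    induction hv using AddSubgroup.closure_induction with
    | mem v hv =>
      simp only [Set.mem_insert_iff, Set.mem_singleton_iff] at hv
      rcases hv with rfl | rfl | rfl | rfl
      · exact ⟨m 0, by simp [pairing_eq, e₁]⟩
      · exact ⟨m 1, by simp [pairing_eq, e₂]⟩
      · exact ⟨m 2, by simp [pairing_eq, e₃]⟩
      · refine ⟨q, ?_⟩
        simp [pairing_eq]
        field_simp
        linear_combination hq'
    | zero => exact ⟨0, by simp [pairing]⟩
    | add v w _ _ h1 h2 =>
      obtain ⟨k, hk⟩ := h1
      obtain ⟨l, hl⟩ := h2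
      refine ⟨k + l, ?_⟩
      rw [pairing_eq] at *
      push_cast
      rw [← hk, ← hl]
      simp only [Pi.add_apply]
      ring
    | neg v _ h1 =>
      obtain ⟨k, hk⟩ := h1
      refine ⟨-k, ?_⟩
      rw [pairing_eq] at *
      push_cast
      rw [← hk]
      simp only [Pi.neg_apply]
      ring

/-- The generators of the rays lie in `N(r, a)`, so monomials have integral orders along them. -/
lemma exists_pairing_rayVec {r a : ℕ} (har : a < r) (hc : Nat.Coprime a r) {m : Fin 3 → ℤ}
    (hm : m ∈ latticeM r a) (o : Option ℕ) : ∃ n : ℤ, pairing m (rayVec r a o) = n := by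
  have hr' : (r : ℝ) ≠ 0 := by exact_mod_cast (show r ≠ 0 by omega)
  cases o with
  | none => exact ⟨m 0, by simp [pairing_eq, rayVec, e₁]⟩
  | some k =>
    obtain ⟨q, hq⟩ := (mem_latticeM_iff (by omega) m).1 hm
    obtain ⟨s, hs⟩ := dvd_mul_alpha_add har hc k
    -- modulo `r`, `α_k m₀ + (r - k) m₁ + k m₂ ≡ (a α_k + k) (m₂ - m₁)`
    refine ⟨alpha r a k * (q - m 2) + s * (m 2 - m 1) + m 1, ?_⟩
    have hq' : (m 0 : ℝ) + a * m 1 + (r - a) * m 2 = r * q := by exact_mod_cast hq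
    have hs' : (a : ℝ) * alpha r a k + k = r * s := by exact_mod_cast hs
    rw [pairing_eq]
    simp only [rayVec, p_apply_zero, p_apply_one, p_apply_two]
    push_cast
    field_simp
    linear_combination (alpha r a k : ℝ) * hq' + ((m 2 : ℝ) - m 1) * hs'

lemma exists_pairing_mapL {r a : ℕ} (ha : 0 < a) (har : a < r) (hc : Nat.Coprime a r)
    {m : Fin 3 → ℤ} (hm : m ∈ latticeM (r - a) (residue (r : ℤ) (r - a))) :
    ∃ n ∈ latticeM r a, ∀ v, pairing n (mapL r a v) = pairing m v := by
  have h0 : 0 < r - a := by omega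
  have hr : (r : ℝ) ≠ 0 := by exact_mod_cast (show r ≠ 0 by omega)
  obtain ⟨q, hq⟩ := (mem_latticeM_iff h0 m).1 hm
  obtain ⟨d, hd⟩ := dvd_sub_residue (r : ℤ) h0
  push_cast [har.le] at hq hd
  have key : m 0 + a * m 1 + (r - a) * (d * (m 2 - m 1) - q + m 2 + m 1) = r * m 2 := by
    linear_combination hq + (m 1 - m 2) * hd
  refine ⟨![m 0, m 1, d * (m 2 - m 1) - q + m 2 + m 1], ?_, ?_⟩
  · rw [mem_latticeM_iff (by omega)]
    exact ⟨m 2, by simpa using key⟩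
  · intro v
    have key' : (m 0 : ℝ) + a * m 1 + (r - a) * (d * (m 2 - m 1) - q + m 2 + m 1) = r * m 2 := by
      exact_mod_cast key
    rw [mapL_apply ha har hc, pairing_eq, pairing_eq]
    simp
    field_simp
    linear_combination v 2 * key'

lemma exists_pairing_mapR {r a : ℕ} (ha : 0 < a) (har : a < r) (hc : Nat.Coprime a r)
    {m : Fin 3 → ℤ} (hm : m ∈ latticeM a (residue (-(r : ℤ)) a)) :
    ∃ n ∈ latticeM r a, ∀ v, pairing n (mapR r a v) = pairing m v := by
  have hr : (r : ℝ) ≠ 0 := by exact_mod_cast (show r ≠ 0 by omega)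
  obtain ⟨q, hq⟩ := (mem_latticeM_iff ha m).1 hm
  obtain ⟨d, hd⟩ := dvd_sub_residue (-(r : ℤ)) ha
  have key : m 0 + a * (d * (m 2 - m 1) - q + 2 * m 2) + (r - a) * m 2 = r * m 1 := by
    linear_combination hq + (m 1 - m 2) * hd
  refine ⟨![m 0, d * (m 2 - m 1) - q + 2 * m 2, m 2], ?_, ?_⟩
  · rw [mem_latticeM_iff (by omega)]
    exact ⟨m 1, by simpa using key⟩
  · intro v
    have key' : (m 0 : ℝ) + a * (d * (m 2 - m 1) - q + 2 * m 2) + (r - a) * m 2 = r * m 1 := by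
      exact_mod_cast key
    rw [mapR_apply ha har hc, pairing_eq, pairing_eq]
    simp
    field_simp
    linear_combination v 1 * key'

/-- The maximal cones are smooth: their generators have a dual basis in `M`. -/
lemma Chart.exists_dual {r a : ℕ} {s : Fin 3 → Option ℕ} (h : Chart r a s) :
    ∃ μ : Fin 3 → Fin 3 → ℤ, (∀ i, μ i ∈ latticeM r a) ∧
      ∀ i j, pairing (μ i) (rayVec r a (s j)) = if i = j then 1 else 0 := by
  induction h with
  | octant =>
    refine ⟨![![1, 0, 0], ![0, 1, 0], ![0, 0, 1]], ?_, ?_⟩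
    · intro i
      rw [mem_latticeM_iff one_pos]
      simp
    · have h0 : ∀ k, alpha 1 0 k = 0 := fun k => by
        have := alpha_lt (r := 1) (a := 0) one_pos k
        omega
      intro i j
      fin_cases i <;> fin_cases j <;>
        simp [pairing_eq, rayVec, e₁, p_apply_zero, p_apply_one, p_apply_two, h0]
  | @top r a ha har hc =>
    have hr : (r : ℝ) ≠ 0 := by exact_mod_cast (show r ≠ 0 by omega)
    refine ⟨![![-a, 1, 0], ![-(r - a), 0, 1], ![r, 0, 0]], ?_, ?_⟩
    · intro i
      rw [mem_latticeM_iff (by omega)]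
      fin_cases i <;> simp
    · intro i j
      fin_cases i <;> fin_cases j <;>
        simp [pairing_eq, rayVec, p_apply_zero, p_apply_one, p_apply_two, alpha_zero har hc,
          alpha_self har hc, alpha_top ha har hc, hr, Nat.cast_sub har.le] <;>
        field_simp <;> ring
  | @left r a ha har hc s hs ih =>
    obtain ⟨μ, hμ, hd⟩ := ih
    choose ν hν hp using fun i => exists_pairing_mapL ha har hc (hμ i)
    exact ⟨ν, hν, fun i j => by
      rw [← mapL_rayVec ha har hc (fun k hk => hs.le j hk), hp, hd]⟩
  | @right r a ha har hc s hs ih =>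
    obtain ⟨μ, hμ, hd⟩ := ih
    choose ν hν hp using fun i => exists_pairing_mapR ha har hc (hμ i)
    exact ⟨ν, hν, fun i j => by
      rw [← mapR_rayVec ha har hc (fun k hk => hs.le j hk), hp, hd]⟩

/-! ### The fan -/

lemma mem_cone_iff {u v w x : Vec} :
    x ∈ cone u v w ↔ ∃ c : Fin 3 → ℝ, (∀ j, 0 ≤ c j) ∧ x = ∑ j, c j • ![u, v, w] j := by
  rw [cone, PointedCone.hull, Submodule.mem_span_triple]
  constructor
  · rintro ⟨α, β, γ, rfl⟩
    refine ⟨![α, β, γ], ?_, ?_⟩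
    · intro j
      fin_cases j
      exacts [α.2, β.2, γ.2]
    · simp [Fin.sum_univ_three]
  · rintro ⟨c, hc, rfl⟩
    exact ⟨⟨c 0, hc 0⟩, ⟨c 1, hc 1⟩, ⟨c 2, hc 2⟩, by
      simp [Fin.sum_univ_three]⟩

lemma map_cone (f : Vec →ₗ[ℝ] Vec) (u v w : Vec) :
    PointedCone.map f (cone u v w) = cone (f u) (f v) (f w) := by
  rw [cone, cone, PointedCone.map, PointedCone.hull, Submodule.map_span]
  simp [Set.image_insert_eq, PointedCone.hull]

/-- The maximal cones of the fan are those of the charts. -/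
lemma exists_chart {r a : ℕ} (har : a < r) (hc : Nat.Coprime a r) : ∀ σ ∈ maxCones r a,
    ∃ s, Chart r a s ∧ σ = cone (rayVec r a (s 0)) (rayVec r a (s 1)) (rayVec r a (s 2)) := by
  refine blowup_induction (P := fun r a => ∀ σ ∈ maxCones r a,
    ∃ s, Chart r a s ∧ σ = cone (rayVec r a (s 0)) (rayVec r a (s 1)) (rayVec r a (s 2)))
    ?_ ?_ r a har hc
  · intro σ hσ
    rw [maxCones, if_neg (by simp)] at hσ
    refine ⟨_, Chart.octant, ?_⟩
    rw [Set.mem_singleton_iff.1 hσ]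
    have h0 : ∀ k, alpha 1 0 k = 0 := fun k => by
      have := alpha_lt (r := 1) (a := 0) one_pos k
      omega
    congr 1
    · funext i
      fin_cases i <;> simp [rayVec, e₂, p_apply_zero, p_apply_one, p_apply_two, h0]
    · funext i
      fin_cases i <;> simp [rayVec, e₃, p_apply_zero, p_apply_one, p_apply_two, h0]
  · intro r a ha har hc h1 h2 σ hσ
    have hr : (r : ℝ) ≠ 0 := by exact_mod_cast (show r ≠ 0 by omega)
    rw [maxCones, if_pos ⟨ha, har⟩] at hσ
    rcases hσ with (hσ | ⟨σ', hσ', rfl⟩) | ⟨σ', hσ', rfl⟩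
    · refine ⟨_, Chart.top ha har hc, ?_⟩
      rw [Set.mem_singleton_iff.1 hσ]
      congr 1
      · funext i
        fin_cases i <;>
          simp [rayVec, e₂, p_apply_zero, p_apply_one, p_apply_two, alpha_zero har hc, hr]
      · funext i
        fin_cases i <;>
          simp [rayVec, e₃, p_apply_zero, p_apply_one, p_apply_two, alpha_self har hc, hr]
    · obtain ⟨s, hs, rfl⟩ := h1 σ' hσ'
      refine ⟨_, Chart.left ha har hc hs, ?_⟩
      have hle := fun j => mapL_rayVec ha har hc (fun k hk => hs.le j hk)
      rw [map_cone, hle, hle, hle]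
    · obtain ⟨s, hs, rfl⟩ := h2 σ' hσ'
      refine ⟨_, Chart.right ha har hc hs, ?_⟩
      have hle := fun j => mapR_rayVec ha har hc (fun k hk => hs.le j hk)
      rw [map_cone, hle, hle, hle]

/-- Each of the rays belongs to some maximal cone. -/
lemma exists_chart_of_ray {r a : ℕ} (har : a < r) (hc : Nat.Coprime a r) :
    ∀ o : Option ℕ, (∀ k, o = some k → k ≤ r) → ∃ s j, Chart r a s ∧ s j = o := by
  refine blowup_induction (P := fun r a => ∀ o : Option ℕ, (∀ k, o = some k → k ≤ r) →
    ∃ s j, Chart r a s ∧ s j = o) ?_ ?_ r a har hc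
  · intro o ho
    cases o with
    | none => exact ⟨_, 0, Chart.octant, rfl⟩
    | some k =>
      have := ho k rfl
      rcases (show k = 0 ∨ k = 1 by omega) with rfl | rfl
      · exact ⟨_, 1, Chart.octant, rfl⟩
      · exact ⟨_, 2, Chart.octant, rfl⟩
  · intro r a ha har hc h1 h2 o ho
    by_cases h : ∀ k, o = some k → k ≤ r - a
    · obtain ⟨s, j, hs, hj⟩ := h1 o h
      exact ⟨s, j, Chart.left ha har hc hs, hj⟩
    · push Not at h
      obtain ⟨k, rfl, hk⟩ := h
      have := ho k rfl
      obtain ⟨s, j, hs, hj⟩ := h2 (some (k - (r - a))) (fun l hl => by simp at hl; omega)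
      refine ⟨_, j, Chart.right ha har hc hs, ?_⟩
      simp only [hj, Option.map_some]
      congr 1
      omega

/-- The linear function on `N ⊗ ℝ` which takes the same values as `D` at `e₁`, `e₂` and `e₃`. -/
def octantLinear (r : ℕ) (D : Option ℕ → ℝ) (v : Vec) : ℝ :=
  v 0 * D none + v 1 * D (some 0) + v 2 * D (some r)

lemma octantLinear_sum (r : ℕ) (D : Option ℕ → ℝ) (c : Fin 3 → ℝ) (u : Fin 3 → Vec) :
    octantLinear r D (∑ j, c j • u j) = ∑ j, c j * octantLinear r D (u j) := by
  simp only [octantLinear, Fin.sum_univ_three, Pi.add_apply, Pi.smul_apply, smul_eq_mul]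
  ring

/-- The boundary of the octant is not subdivided: the only rays in it are those of `e₁`, `e₂` and
`e₃`. -/
lemma octantLinear_rayVec {r a : ℕ} (har : a < r) (hc : Nat.Coprime a r) (D : Option ℕ → ℝ)
    {o : Option ℕ} (ho : ∀ k, o = some k → k ≤ r) {i : Fin 3} (hi : rayVec r a o i = 0) :
    octantLinear r D (rayVec r a o) = D o := by
  have hr : (r : ℝ) ≠ 0 := by exact_mod_cast (show r ≠ 0 by omega)
  cases o with
  | none => simp [octantLinear, rayVec, e₁]
  | some k =>
    have h : k = 0 ∨ k = r := by
      fin_cases i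
      · have h1 : (alpha r a k : ℝ) / r = 0 := (p_apply_zero r a k).symm.trans hi
        exact eq_zero_or_eq_of_alpha_eq_zero har hc (ho k rfl) (by simpa [hr] using h1)
      · have h1 : ((r : ℝ) - k) / r = 0 := (p_apply_one r a k).symm.trans hi
        right
        have h2 : (r : ℝ) - k = 0 := by simpa [hr] using h1
        exact_mod_cast (sub_eq_zero.1 h2).symm
      · have h1 : (k : ℝ) / r = 0 := (p_apply_two r a k).symm.trans hi
        left
        simpa [hr] using h1
    rcases h with rfl | rfl
    · simp [octantLinear, rayVec, p_apply_zero, p_apply_one, p_apply_two, alpha_zero har hc, hr]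
    · simp [octantLinear, rayVec, p_apply_zero, p_apply_one, p_apply_two, alpha_self har hc, hr]

lemma Chart.sum_eq_octantLinear {r a : ℕ} {s : Fin 3 → Option ℕ} (h : Chart r a s)
    {c : Fin 3 → ℝ} (hc : ∀ j, 0 ≤ c j) (D : Option ℕ → ℝ) (i : Fin 3)
    (hi : (∑ j, c j • rayVec r a (s j)) i = 0) :
    ∑ j, c j * D (s j) = octantLinear r D (∑ j, c j • rayVec r a (s j)) := by
  rw [octantLinear_sum]
  refine Finset.sum_congr rfl fun j _ => ?_
  have h1 : ∀ k ∈ Finset.univ, 0 ≤ c k * rayVec r a (s k) i := fun k _ =>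
    mul_nonneg (hc k) (rayVec_nonneg r a (fun _ hk => h.le k hk) i)
  have h2 : ∑ k, c k * rayVec r a (s k) i = 0 := by simpa using hi
  have h3 := (Finset.sum_eq_zero_iff_of_nonneg h1).1 h2 j (Finset.mem_univ j)
  rcases mul_eq_zero.1 h3 with h4 | h4
  · rw [h4, zero_mul, zero_mul]
  · rw [octantLinear_rayVec h.lt h.coprime D (fun _ hk => h.le j hk) h4]

lemma Chart.sum_nonneg {r a : ℕ} {s : Fin 3 → Option ℕ} (h : Chart r a s)
    {c : Fin 3 → ℝ} (hc : ∀ j, 0 ≤ c j) (i : Fin 3) :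
    0 ≤ (∑ j, c j • rayVec r a (s j)) i := by
  have : (∑ j, c j • rayVec r a (s j)) i = ∑ j, c j * rayVec r a (s j) i := by simp
  rw [this]
  exact Finset.sum_nonneg fun k _ =>
    mul_nonneg (hc k) (rayVec_nonneg r a (fun _ hk => h.le k hk) i)

lemma Chart.coeff_unique {r a : ℕ} {s : Fin 3 → Option ℕ} (h : Chart r a s) {c c' : Fin 3 → ℝ}
    (he : ∑ j, c j • rayVec r a (s j) = ∑ j, c' j • rayVec r a (s j)) : c = c' := by
  obtain ⟨μ, -, hμ⟩ := h.exists_dual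
  funext i
  have := congrArg (pairing (μ i)) he
  simpa [pairing_sum_smul, hμ] using this

lemma mapL_injective {r a : ℕ} (ha : 0 < a) (har : a < r) (hc : Nat.Coprime a r) :
    Function.Injective (mapL r a) := by
  intro v w h
  have hr : (r : ℝ) ≠ 0 := by exact_mod_cast (show r ≠ 0 by omega)
  have hra : (r : ℝ) - a ≠ 0 := by
    have : ((r - a : ℕ) : ℝ) ≠ 0 := by exact_mod_cast (show r - a ≠ 0 by omega)
    rwa [Nat.cast_sub har.le] at this
  rw [mapL_apply ha har hc, mapL_apply ha har hc] at h
  have h0 := congrFun h 0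
  have h1 := congrFun h 1
  have h2 := congrFun h 2
  simp [hr, hra] at h0 h1 h2
  rw [h2] at h0 h1
  funext i
  fin_cases i
  · exact add_right_cancel h0
  · exact add_right_cancel h1
  · exact h2

lemma mapR_injective {r a : ℕ} (ha : 0 < a) (har : a < r) (hc : Nat.Coprime a r) :
    Function.Injective (mapR r a) := by
  intro v w h
  have hr : (r : ℝ) ≠ 0 := by exact_mod_cast (show r ≠ 0 by omega)
  have ha' : (a : ℝ) ≠ 0 := by exact_mod_cast (show a ≠ 0 by omega)
  rw [mapR_apply ha har hc, mapR_apply ha har hc] at h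
  have h0 := congrFun h 0
  have h1 := congrFun h 1
  have h2 := congrFun h 2
  simp [hr, ha'] at h0 h1 h2
  rw [h1] at h0 h2
  funext i
  fin_cases i
  · exact add_right_cancel h0
  · exact h1
  · exact add_left_cancel h2

lemma mapL_sum {r a : ℕ} (ha : 0 < a) (har : a < r) (hc : Nat.Coprime a r)
    {s : Fin 3 → Option ℕ} (hs : Chart (r - a) (residue (r : ℤ) (r - a)) s) (c : Fin 3 → ℝ) :
    mapL r a (∑ j, c j • rayVec (r - a) (residue (r : ℤ) (r - a)) (s j)) =
      ∑ j, c j • rayVec r a (s j) := by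
  rw [map_sum]
  refine Finset.sum_congr rfl fun j _ => ?_
  rw [map_smul, mapL_rayVec ha har hc (fun k hk => hs.le j hk)]

lemma mapR_sum {r a : ℕ} (ha : 0 < a) (har : a < r) (hc : Nat.Coprime a r)
    {s : Fin 3 → Option ℕ} (hs : Chart a (residue (-(r : ℤ)) a) s) (c : Fin 3 → ℝ) :
    mapR r a (∑ j, c j • rayVec a (residue (-(r : ℤ)) a) (s j)) =
      ∑ j, c j • rayVec r a ((s j).map fun k => r - a + k) := by
  rw [map_sum]
  refine Finset.sum_congr rfl fun j _ => ?_
  rw [map_smul, mapR_rayVec ha har hc (fun k hk => hs.le j hk)]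

/-- The coordinates of a vector of the cone `⟨e₂, e₃, p_{r-a}⟩`. -/
lemma sum_top {r a : ℕ} (ha : 0 < a) (har : a < r) (hc : Nat.Coprime a r) (c : Fin 3 → ℝ) :
    ∑ j, c j • rayVec r a (![some 0, some r, some (r - a)] j) =
      ![c 2 / r, c 0 + c 2 * a / r, c 1 + c 2 * ((r : ℝ) - a) / r] := by
  have hr : (r : ℝ) ≠ 0 := by exact_mod_cast (show r ≠ 0 by omega)
  funext i
  fin_cases i <;>
    simp [Fin.sum_univ_three, rayVec, p_apply_zero, p_apply_one, p_apply_two, alpha_zero har hc,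
      alpha_self har hc, alpha_top ha har hc, hr, Nat.cast_sub har.le, div_eq_mul_inv, mul_assoc]

/-- The cones of the charts form a fan: each function `D` on the set of rays extends to a function
on the union of the cones which is linear on each of them. -/
lemma Chart.piecewise_linear {r a : ℕ} (har : a < r) (hc : Nat.Coprime a r) :
    ∀ s s', Chart r a s → Chart r a s' → ∀ c c' : Fin 3 → ℝ, (∀ j, 0 ≤ c j) → (∀ j, 0 ≤ c' j) →
      ∑ j, c j • rayVec r a (s j) = ∑ j, c' j • rayVec r a (s' j) →
      ∀ D : Option ℕ → ℝ, ∑ j, c j * D (s j) = ∑ j, c' j * D (s' j) := by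
  refine blowup_induction (P := fun r a => ∀ s s', Chart r a s → Chart r a s' →
    ∀ c c' : Fin 3 → ℝ, (∀ j, 0 ≤ c j) → (∀ j, 0 ≤ c' j) →
      ∑ j, c j • rayVec r a (s j) = ∑ j, c' j • rayVec r a (s' j) →
      ∀ D : Option ℕ → ℝ, ∑ j, c j * D (s j) = ∑ j, c' j * D (s' j)) ?_ ?_ r a har hc
  · have hoct : ∀ s, Chart 1 0 s → s = ![none, some 0, some 1] := by
      intro s hs
      cases hs with
      | octant => rfl
      | top ha => omega
      | left ha => omega
      | right ha => omega
    intro s s' hs hs' c c' _ _ he D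
    obtain rfl := hoct s hs
    obtain rfl := hoct s' hs'
    rw [hs.coeff_unique he]
  · intro r a ha har hc ih1 ih2
    have h0 : 0 < r - a := by omega
    have hr : (0 : ℝ) < r := by exact_mod_cast (show 0 < r by omega)
    have ha' : (0 : ℝ) < a := by exact_mod_cast ha
    have hra : (0 : ℝ) < r - a := sub_pos.2 (by exact_mod_cast har)
    -- a common vector of `⟨e₂, e₃, p_{r-a}⟩` and of the octant of index `r - a` is in
    -- `⟨e₂, p_{r-a}⟩`, which is a part of the boundary of that octant
    have top_left : ∀ s, Chart (r - a) (residue (r : ℤ) (r - a)) s → ∀ c c' : Fin 3 → ℝ,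
        (∀ j, 0 ≤ c j) → (∀ j, 0 ≤ c' j) →
        ∑ j, c j • rayVec r a (![some 0, some r, some (r - a)] j) =
          ∑ j, c' j • rayVec r a (s j) → ∀ D : Option ℕ → ℝ,
        ∑ j, c j * D (![some 0, some r, some (r - a)] j) = ∑ j, c' j * D (s j) := by
      intro s hs c c' hc0 hc0' he D
      rw [sum_top ha har hc, ← mapL_sum ha har hc hs, mapL_apply ha har hc] at he
      have hn := hs.sum_nonneg hc0'
      have hb := hs.sum_eq_octantLinear hc0' D 0
      generalize ∑ j, c' j • rayVec (r - a) (residue (r : ℤ) (r - a)) (s j) = v at he hn hb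
      have e0 := congrFun he 0
      have e1 := congrFun he 1
      have e2 := congrFun he 2
      simp at e0 e1 e2
      field_simp at e0 e1 e2
      have h1 : c 1 = -(r - a) * v 0 := by
        refine mul_right_cancel₀ hr.ne' ?_
        linear_combination e2 - (r - a) * e0
      have hv : v 0 = 0 := by nlinarith [hc0 1, hn 0]
      have h2 : c 0 = v 1 := by
        refine mul_right_cancel₀ hr.ne' ?_
        linear_combination e1 - a * e0 - r * a * hv
      rw [hb hv]
      simp only [octantLinear, Fin.sum_univ_three]
      simp
      rw [h1, h2, e0, hv]
      ring
    have top_right : ∀ s, Chart a (residue (-(r : ℤ)) a) s → ∀ c c' : Fin 3 → ℝ,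
        (∀ j, 0 ≤ c j) → (∀ j, 0 ≤ c' j) →
        ∑ j, c j • rayVec r a (![some 0, some r, some (r - a)] j) =
          ∑ j, c' j • rayVec r a ((s j).map fun k => r - a + k) → ∀ D : Option ℕ → ℝ,
        ∑ j, c j * D (![some 0, some r, some (r - a)] j) =
          ∑ j, c' j * D ((s j).map fun k => r - a + k) := by
      intro s hs c c' hc0 hc0' he D
      rw [sum_top ha har hc, ← mapR_sum ha har hc hs, mapR_apply ha har hc] at he
      have hn := hs.sum_nonneg hc0'
      have hb := hs.sum_eq_octantLinear hc0' (fun o => D (o.map fun k => r - a + k)) 0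
      generalize ∑ j, c' j • rayVec a (residue (-(r : ℤ)) a) (s j) = v at he hn hb
      have e0 := congrFun he 0
      have e1 := congrFun he 1
      have e2 := congrFun he 2
      simp at e0 e1 e2
      field_simp at e0 e1 e2
      have h1 : c 0 = -a * v 0 := by
        refine mul_right_cancel₀ hr.ne' ?_
        linear_combination e1 - a * e0
      have hv : v 0 = 0 := by nlinarith [hc0 0, hn 0]
      have h2 : c 1 = v 2 := by
        refine mul_right_cancel₀ hr.ne' ?_
        linear_combination e2 - (r - a) * e0 - r * (r - a) * hv
      rw [hb hv]
      simp only [octantLinear, Fin.sum_univ_three]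
      simp [Nat.sub_add_cancel har.le]
      rw [h1, h2, e0, hv]
      ring
    have left_right : ∀ s s', Chart (r - a) (residue (r : ℤ) (r - a)) s →
        Chart a (residue (-(r : ℤ)) a) s' → ∀ c c' : Fin 3 → ℝ,
        (∀ j, 0 ≤ c j) → (∀ j, 0 ≤ c' j) →
        ∑ j, c j • rayVec r a (s j) =
          ∑ j, c' j • rayVec r a ((s' j).map fun k => r - a + k) → ∀ D : Option ℕ → ℝ,
        ∑ j, c j * D (s j) = ∑ j, c' j * D ((s' j).map fun k => r - a + k) := by
      intro s s' hs hs' c c' hc0 hc0' he D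
      rw [← mapL_sum ha har hc hs, ← mapR_sum ha har hc hs', mapL_apply ha har hc,
        mapR_apply ha har hc] at he
      have hn := hs.sum_nonneg hc0
      have hn' := hs'.sum_nonneg hc0'
      have hb := hs.sum_eq_octantLinear hc0 D 1
      have hb' := hs'.sum_eq_octantLinear hc0' (fun o => D (o.map fun k => r - a + k)) 2
      generalize ∑ j, c j • rayVec (r - a) (residue (r : ℤ) (r - a)) (s j) = v at he hn hb
      generalize ∑ j, c' j • rayVec a (residue (-(r : ℤ)) a) (s' j) = w at he hn' hb'
      have e0 := congrFun he 0
      have e1 := congrFun he 1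
      have e2 := congrFun he 2
      simp at e0 e1 e2
      field_simp at e0 e1 e2
      have h1 : (r - a) * v 1 + a * w 2 = 0 := by
        refine mul_left_cancel₀ hr.ne' ?_
        linear_combination (r - a) * e1 - a * e2
      have hv : v 1 = 0 := by nlinarith [hn 1, hn' 2, mul_nonneg ha'.le (hn' 2)]
      have hw : w 2 = 0 := by
        rw [hv, mul_zero, zero_add] at h1
        exact (mul_eq_zero.1 h1).resolve_left ha'.ne'
      have h2 : v 2 = w 1 := by
        refine mul_right_cancel₀ ha'.ne' ?_
        linear_combination e1 - r * hv
      have h3 : v 0 = w 0 := by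
        refine mul_right_cancel₀ hr.ne' ?_
        linear_combination e0 - h2
      rw [hb hv, hb' hw]
      simp only [octantLinear]
      simp
      rw [hv, hw, h2, h3]
      ring
    intro s s' hs hs' c c' hc0 hc0' he D
    cases hs with
    | octant => omega
    | top _ _ _ =>
      generalize hs0 : s' = s0 at hs'
      cases hs' with
      | octant => omega
      | top _ _ _ => subst hs0; rw [(Chart.top ha har hc).coeff_unique he]
      | left _ _ _ h' => subst hs0; exact top_left _ h' c c' hc0 hc0' he D
      | right _ _ _ h' => subst hs0; exact top_right _ h' c c' hc0 hc0' he D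
    | left _ _ _ h =>
      cases hs' with
      | octant => omega
      | top _ _ _ => exact (top_left _ h c' c hc0' hc0 he.symm D).symm
      | left _ _ _ h' =>
        rw [← mapL_sum ha har hc h, ← mapL_sum ha har hc h'] at he
        exact ih1 _ _ h h' c c' hc0 hc0' (mapL_injective ha har hc he) D
      | right _ _ _ h' => exact left_right _ _ h h' c c' hc0 hc0' he D
    | right _ _ _ h =>
      cases hs' with
      | octant => omega
      | top _ _ _ => exact (top_right _ h c' c hc0' hc0 he.symm D).symm
      | left _ _ _ h' => exact (left_right _ _ h' h c' c hc0' hc0 he.symm D).symm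
      | right _ _ _ h' =>
        rw [← mapR_sum ha har hc h, ← mapR_sum ha har hc h'] at he
        exact ih2 _ _ h h' c c' hc0 hc0' (mapR_injective ha har hc he)
          (fun o => D (o.map fun k => r - a + k))

/-- A ray of the fan which lies in a maximal cone is one of its edges. -/
lemma Chart.mem_of_rayVec {r a : ℕ} {s : Fin 3 → Option ℕ} (h : Chart r a s) {o : Option ℕ}
    (ho : ∀ k, o = some k → k ≤ r) {c : Fin 3 → ℝ} (hc : ∀ j, 0 ≤ c j)
    (he : rayVec r a o = ∑ j, c j • rayVec r a (s j)) : ∃ j, s j = o := by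
  obtain ⟨s', j', hs', hj'⟩ := exists_chart_of_ray h.lt h.coprime o ho
  by_contra hcon
  push Not at hcon
  have key := Chart.piecewise_linear h.lt h.coprime s' s hs' h (Pi.single j' 1) c
    (fun j => by by_cases hj : j = j' <;> simp [hj]) hc
    (by rw [← he, ← hj']; simp [Pi.single_apply])
    (fun o' => if o' = o then 1 else 0)
  simp only [Pi.single_apply, ite_mul, one_mul, zero_mul, Finset.sum_ite_eq', Finset.mem_univ,
    if_true, hj'] at key
  simp [hcon] at key

/-! ### Smooth toric charts -/

/-- The order of vanishing of `χ^m` along the prime divisor of a ray.  The pairing is integral, so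
that the floor only turns it into an integer. -/
noncomputable def order {r a : ℕ} (ρ : Ray r) (m : latticeM r a) : ℤ :=
  ⌊pairing m (ρ.gen r a)⌋

lemma coe_order {r a : ℕ} (har : a < r) (hc : Nat.Coprime a r) (ρ : Ray r) (m : latticeM r a) :
    (order ρ m : ℝ) = pairing m (ρ.gen r a) := by
  obtain ⟨n, hn⟩ := exists_pairing_rayVec har hc m.2 ρ.label
  rw [← Ray.gen_eq] at hn
  rw [order, hn, Int.floor_intCast]

lemma order_add {r a : ℕ} (har : a < r) (hc : Nat.Coprime a r) (ρ : Ray r) (m n : latticeM r a) :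
    order ρ (m + n) = order ρ m + order ρ n := by
  have h : (order ρ (m + n) : ℝ) = order ρ m + order ρ n := by
    rw [coe_order har hc, coe_order har hc, coe_order har hc]
    exact pairing_add _ _ _
  exact_mod_cast h

/-- The data which describe a chart `U_σ ≅ 𝔸³`: the three rays of the maximal cone `σ`, and the
basis of `M` which is dual to their generators. -/
structure ChartData (r a : ℕ) (σ : PointedCone ℝ Vec) where
  ray : Fin 3 → Ray r
  chart : Chart r a fun j => (ray j).label
  dual : Fin 3 → latticeM r a
  pairing_dual : ∀ i j, pairing (dual i) ((ray j).gen r a) = if i = j then 1 else 0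
  mem_iff : ∀ v, v ∈ σ ↔ ∃ c : Fin 3 → ℝ, (∀ j, 0 ≤ c j) ∧ v = ∑ j, c j • (ray j).gen r a

lemma nonempty_chartData {r a : ℕ} (har : a < r) (hc : Nat.Coprime a r) {σ : PointedCone ℝ Vec}
    (hσ : σ ∈ maxCones r a) : Nonempty (ChartData r a σ) := by
  obtain ⟨s, hs, rfl⟩ := exists_chart har hc σ hσ
  choose ρ hρ using fun j => Ray.exists_label_eq (r := r) (fun k hk => hs.le j hk)
  obtain ⟨μ, hμ, hd⟩ := hs.exists_dual
  have hs' : (fun j => (ρ j).label) = s := funext hρ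
  refine ⟨⟨ρ, hs' ▸ hs, fun i => ⟨μ i, hμ i⟩, fun i j => ?_, fun v => ?_⟩⟩
  · rw [Ray.gen_eq, hρ]
    exact hd i j
  · rw [mem_cone_iff]
    simp only [Ray.gen_eq, hρ, Fin.sum_univ_three]
    rfl

namespace ChartData

lemma lt {r a : ℕ} {σ : PointedCone ℝ Vec} (C : ChartData r a σ) : a < r := C.chart.lt

lemma coprime {r a : ℕ} {σ : PointedCone ℝ Vec} (C : ChartData r a σ) : Nat.Coprime a r :=
  C.chart.coprime

variable {r a : ℕ} {σ : PointedCone ℝ Vec} (C : ChartData r a σ)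

lemma gen_mem (j : Fin 3) : (C.ray j).gen r a ∈ σ := by
  rw [C.mem_iff]
  exact ⟨Pi.single j 1, fun i => by by_cases h : i = j <;> simp [h], by simp [Pi.single_apply]⟩

lemma exists_ray_eq {ρ : Ray r} (h : ρ.gen r a ∈ σ) : ∃ j, C.ray j = ρ := by
  obtain ⟨c, hc, he⟩ := (C.mem_iff _).1 h
  simp only [Ray.gen_eq] at he
  obtain ⟨j, hj⟩ := C.chart.mem_of_rayVec (o := ρ.label)
    (fun k hk => by cases ρ with
      | e₁ => simp [Ray.label] at hk
      | p l => simp [Ray.label] at hk; omega) hc he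
  exact ⟨j, Ray.label_injective r hj⟩

lemma mem_dualMonoid_iff (m : latticeM r a) :
    m ∈ dualMonoid r a σ ↔ ∀ j, 0 ≤ pairing m ((C.ray j).gen r a) := by
  constructor
  · exact fun h j => h _ (C.gen_mem j)
  · intro h v hv
    obtain ⟨c, hc, rfl⟩ := (C.mem_iff v).1 hv
    rw [pairing_sum_smul]
    exact Finset.sum_nonneg fun j _ => mul_nonneg (hc j) (h j)

/-- A monomial is determined by its orders along the rays of a chart. -/
lemma eq_of_pairing_eq {m n : latticeM r a}
    (h : ∀ j, pairing m ((C.ray j).gen r a) = pairing n ((C.ray j).gen r a)) : m = n := by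
  let U : Matrix (Fin 3) (Fin 3) ℝ := fun i k => ((C.dual i : Fin 3 → ℤ) k : ℝ)
  let G : Matrix (Fin 3) (Fin 3) ℝ := fun k j => (C.ray j).gen r a k
  have hUG : U * G = 1 := by
    ext i j
    rw [Matrix.mul_apply, Matrix.one_apply]
    exact C.pairing_dual i j
  have hGU : G * U = 1 := mul_eq_one_comm.1 hUG
  let M : Fin 3 → ℝ := fun k => ((m : Fin 3 → ℤ) k : ℝ)
  let N : Fin 3 → ℝ := fun k => ((n : Fin 3 → ℤ) k : ℝ)
  have hMN : Matrix.vecMul M G = Matrix.vecMul N G := funext h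
  have h2 : M = N := by
    have := congrArg (fun x => Matrix.vecMul x U) hMN
    simpa [Matrix.vecMul_vecMul, hGU] using this
  refine Subtype.ext (funext fun k => ?_)
  have h3 : ((m : Fin 3 → ℤ) k : ℝ) = ((n : Fin 3 → ℤ) k : ℝ) := congrFun h2 k
  exact_mod_cast h3

/-- The exponent `m` such that `χ^m` has divisor `D` on the chart. -/
def frame (D : Divisor r) : latticeM r a := ∑ j, D (C.ray j) • C.dual j

lemma pairing_frame (D : Divisor r) (j : Fin 3) :
    pairing (C.frame D) ((C.ray j).gen r a) = D (C.ray j) := by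
  have h := fun i => C.pairing_dual i j
  simp only [pairing_eq] at h
  simp only [frame, pairing_eq, Fin.sum_univ_three, AddSubgroup.coe_add, AddSubgroup.coe_zsmul,
    Pi.add_apply, Pi.smul_apply, smul_eq_mul]
  push_cast
  have h0 := h 0
  have h1 := h 1
  have h2 := h 2
  have h3 : (D (C.ray j) : ℝ) = D (C.ray 0) * (if 0 = j then 1 else 0)
      + D (C.ray 1) * (if 1 = j then 1 else 0) + D (C.ray 2) * (if 2 = j then 1 else 0) := by
    fin_cases j <;> simp
  linear_combination (D (C.ray 0) : ℝ) * h0 + (D (C.ray 1) : ℝ) * h1 + (D (C.ray 2) : ℝ) * h2 - h3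

lemma frame_add (D D' : Divisor r) : C.frame (D + D') = C.frame D + C.frame D' := by
  simp [frame, add_smul, Finset.sum_add_distrib]

lemma frame_zero : C.frame 0 = 0 := by simp [frame]

lemma frame_eq {D : Divisor r} {m : latticeM r a}
    (h : ∀ ρ : Ray r, (D ρ : ℝ) = pairing m (ρ.gen r a)) : C.frame D = m :=
  C.eq_of_pairing_eq fun j => by rw [C.pairing_frame, h]

lemma frame_mem {D : Divisor r} (hD : ∀ ρ, 0 ≤ D ρ) : C.frame D ∈ dualMonoid r a σ :=
  (C.mem_dualMonoid_iff _).2 fun j => by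
    rw [C.pairing_frame]
    exact_mod_cast hD _

end ChartData

/-! ### Frames of the line bundles -/

lemma toTorus_single {r a : ℕ} {σ : PointedCone ℝ Vec} (m : dualMonoid r a σ) (c : ℂ) :
    toTorus r a σ (AddMonoidAlgebra.single m c) = AddMonoidAlgebra.single (m : latticeM r a) c := by
  simp [toTorus]

lemma toTorus_injective {r a : ℕ} (σ : PointedCone ℝ Vec) :
    Function.Injective (toTorus r a σ) := by
  intro f g h
  simp only [toTorus, AddMonoidAlgebra.mapDomainAlgHom_apply] at h
  exact AddMonoidAlgebra.mapDomain_injective Subtype.val_injective h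

lemma mem_dualMonoid_of_coeff_toTorus {r a : ℕ} {σ : PointedCone ℝ Vec} {g : CoordRing r a σ}
    {m : latticeM r a} (h : (toTorus r a σ g).coeff m ≠ 0) : m ∈ dualMonoid r a σ := by
  simp only [toTorus, AddMonoidAlgebra.mapDomainAlgHom_apply, AddMonoidAlgebra.coeff_mapDomain] at h
  obtain ⟨n, rfl⟩ := Finsupp.mem_range_of_mapDomain_ne_zero h
  exact n.2

lemma mem_range_toTorus {r a : ℕ} {σ : PointedCone ℝ Vec} {f : TorusRing r a}
    (h : ∀ m, f.coeff m ≠ 0 → m ∈ dualMonoid r a σ) : f ∈ (toTorus r a σ).range := by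
  rw [← AddMonoidAlgebra.sum_coeff_single f, Finsupp.sum]
  refine Subalgebra.sum_mem _ fun m hm => ?_
  exact ⟨AddMonoidAlgebra.single ⟨m, h m (Finsupp.mem_support_iff.1 hm)⟩ (f.coeff m),
    toTorus_single _ _⟩

lemma chi_mul_chi_neg {r a : ℕ} (m : latticeM r a) : chi r a m * chi r a (-m) = 1 := by
  rw [chi, chi, AddMonoidAlgebra.single_mul_single, add_neg_cancel, mul_one]
  rfl

lemma ChartData.isFrame_frame {r a : ℕ} {σ : PointedCone ℝ Vec} (C : ChartData r a σ)
    (D : Divisor r) : IsFrame r a σ D (C.frame D) := by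
  ext f
  constructor
  · intro hf
    have h1 : f * chi r a (C.frame D) ∈ (toTorus r a σ).range := by
      refine mem_range_toTorus fun m hm => (C.mem_dualMonoid_iff m).2 fun j => ?_
      rw [chi, AddMonoidAlgebra.coeff_mul_single_apply, mul_one] at hm
      have h2 := hf _ hm (C.ray j) (C.gen_mem j)
      rw [AddSubgroup.coe_add, AddSubgroup.coe_neg, pairing_add, pairing_neg,
        C.pairing_frame] at h2
      linarith
    obtain ⟨g, hg⟩ := h1
    refine ⟨g, ?_⟩
    have hg' : toTorus r a σ g = f * chi r a (C.frame D) := hg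
    simp only [hg', mul_assoc, chi_mul_chi_neg, mul_one]
  · rintro ⟨g, rfl⟩ m hm ρ hρ
    obtain ⟨j, rfl⟩ := C.exists_ray_eq hρ
    simp only [chi, AddMonoidAlgebra.coeff_mul_single_apply, mul_one, neg_neg] at hm
    have h2 := mem_dualMonoid_of_coeff_toTorus hm _ hρ
    rw [AddSubgroup.coe_add, pairing_add, C.pairing_frame] at h2
    linarith

lemma ChartData.eq_frame {r a : ℕ} {σ : PointedCone ℝ Vec} (C : ChartData r a σ)
    {D : Divisor r} {m : latticeM r a} (h : IsFrame r a σ D m) : m = C.frame D := by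
  have h1 : chi r a (-m) ∈ sections r a σ D := by
    rw [h]
    exact ⟨1, by simp⟩
  have h2 : chi r a (-C.frame D) ∈ Set.range fun g => toTorus r a σ g * chi r a (-m) := by
    rw [← h, C.isFrame_frame D]
    exact ⟨1, by simp⟩
  obtain ⟨g, hg⟩ := h2
  have hg' : toTorus r a σ g = chi r a (m - C.frame D) := by
    calc toTorus r a σ g = toTorus r a σ g * (chi r a m * chi r a (-m)) := by
          rw [chi_mul_chi_neg, mul_one]
      _ = toTorus r a σ g * chi r a (-m) * chi r a m := by ring
      _ = chi r a (-C.frame D) * chi r a m := by rw [← hg]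
      _ = chi r a (m - C.frame D) := by
          rw [chi, chi, chi, AddMonoidAlgebra.single_mul_single, mul_one, neg_add_eq_sub]
  have h3 : m - C.frame D ∈ dualMonoid r a σ :=
    mem_dualMonoid_of_coeff_toTorus (g := g) (by rw [hg', chi]; simp)
  refine C.eq_of_pairing_eq fun j => le_antisymm ?_ ?_
  · have h4 := h1 (-m) (by rw [chi]; simp) (C.ray j) (C.gen_mem j)
    rw [AddSubgroup.coe_neg, pairing_neg] at h4
    rw [C.pairing_frame]
    linarith
  · have h4 := h3 _ (C.gen_mem j)
    rw [AddSubgroup.coe_sub, sub_eq_add_neg, pairing_add, pairing_neg] at h4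
    linarith

/-! ### Values of monomials -/

/-- The value of the monomial `χ^m` at a point of a chart. -/
noncomputable def monoVal {r a : ℕ} {σ : PointedCone ℝ Vec} (u : Pt r a σ)
    (m : dualMonoid r a σ) : ℂ :=
  u (AddMonoidAlgebra.single m 1)

lemma monoVal_zero {r a : ℕ} {σ : PointedCone ℝ Vec} (u : Pt r a σ) : monoVal u 0 = 1 :=
  map_one u

lemma monoVal_add {r a : ℕ} {σ : PointedCone ℝ Vec} (u : Pt r a σ) (m n : dualMonoid r a σ) :
    monoVal u (m + n) = monoVal u m * monoVal u n := by
  rw [monoVal, monoVal, monoVal, ← map_mul, AddMonoidAlgebra.single_mul_single, mul_one]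

lemma monoVal_nsmul {r a : ℕ} {σ : PointedCone ℝ Vec} (u : Pt r a σ) (k : ℕ)
    (m : dualMonoid r a σ) : monoVal u (k • m) = monoVal u m ^ k := by
  rw [monoVal, monoVal, ← map_pow, AddMonoidAlgebra.single_pow, one_pow]

lemma pt_ext {r a : ℕ} {σ : PointedCone ℝ Vec} {u v : Pt r a σ}
    (h : ∀ m, monoVal u m = monoVal v m) : u = v :=
  AddMonoidAlgebra.algHom_ext h (Subsingleton.elim _ _)

lemma monoVal_chartMap {r a : ℕ} {σ τ : PointedCone ℝ Vec} (h : τ ≤ σ) (w : Pt r a τ)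
    (m : dualMonoid r a σ) :
    monoVal (chartMap r a h w) m = monoVal w ⟨m, dualMonoid_anti r a h m.2⟩ := by
  simp only [monoVal, chartMap, AlgHom.comp_apply, AddMonoidAlgebra.mapDomainAlgHom_apply,
    AddMonoidAlgebra.mapDomain_single]
  rfl

namespace ChartData

variable {r a : ℕ} {σ : PointedCone ℝ Vec} (C : ChartData r a σ)

lemma dual_mem (j : Fin 3) : C.dual j ∈ dualMonoid r a σ :=
  (C.mem_dualMonoid_iff _).2 fun i => by
    rw [C.pairing_dual]
    split_ifs <;> norm_num

/-- The coordinates of a point of the chart `U_σ ≅ 𝔸³`. -/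
noncomputable def coord (u : Pt r a σ) (j : Fin 3) : ℂ := monoVal u ⟨C.dual j, C.dual_mem j⟩

/-- A monomial is a product of powers of the coordinates. -/
lemma monoVal_eq_prod (u : Pt r a σ) (m : dualMonoid r a σ) :
    monoVal u m = ∏ j, C.coord u j ^ (order (C.ray j) (m : latticeM r a)).toNat := by
  have hm := (C.mem_dualMonoid_iff (m : latticeM r a)).1 m.2
  have hz : ∀ j, 0 ≤ order (C.ray j) (m : latticeM r a) := fun j => Int.floor_nonneg.2 (hm j)
  have key : m = ∑ j, (order (C.ray j) (m : latticeM r a)).toNat •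
      (⟨C.dual j, C.dual_mem j⟩ : dualMonoid r a σ) := by
    refine Subtype.ext ?_
    have h1 : (m : latticeM r a) = C.frame fun ρ => order ρ (m : latticeM r a) :=
      (C.frame_eq fun ρ => coe_order C.lt C.coprime ρ _).symm
    rw [AddSubmonoid.coe_finsetSum]
    conv_lhs => rw [h1, frame]
    refine Finset.sum_congr rfl fun j _ => ?_
    rw [AddSubmonoidClass.coe_nsmul, ← natCast_zsmul, Int.toNat_of_nonneg (hz j)]
  conv_lhs => rw [key]
  simp only [Fin.sum_univ_three, Fin.prod_univ_three, monoVal_add, monoVal_nsmul, coord]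

lemma ext_coord {u v : Pt r a σ} (h : ∀ j, C.coord u j = C.coord v j) : u = v :=
  pt_ext fun m => by simp only [C.monoVal_eq_prod, h]

/-- The natural section of `𝒪(D)`, for effective `D`, is a monomial in the coordinates. -/
lemma monoVal_frame (u : Pt r a σ) {D : Divisor r} (hD : ∀ ρ, 0 ≤ D ρ) :
    monoVal u ⟨C.frame D, C.frame_mem hD⟩ = ∏ j, C.coord u j ^ (D (C.ray j)).toNat := by
  rw [C.monoVal_eq_prod]
  refine Finset.prod_congr rfl fun j _ => ?_
  rw [order, C.pairing_frame, Int.floor_intCast]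

lemma isSectionValue_iff (u : Pt r a σ) {D : Divisor r} (hD : ∀ ρ, 0 ≤ D ρ) (c : ℂ) :
    IsSectionValue r a u D c ↔ c = monoVal u ⟨C.frame D, C.frame_mem hD⟩ := by
  constructor
  · rintro ⟨m, g, hm, hg, rfl⟩
    obtain rfl := C.eq_frame hm
    have h1 : toTorus r a σ g = chi r a (C.frame D) := by
      calc toTorus r a σ g
          = toTorus r a σ g * chi r a (-C.frame D) * chi r a (C.frame D) := by
            rw [mul_assoc, mul_comm (chi r a (-C.frame D)), chi_mul_chi_neg, mul_one]
        _ = chi r a (C.frame D) := by rw [hg, one_mul]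
    have h2 : g = AddMonoidAlgebra.single ⟨C.frame D, C.frame_mem hD⟩ 1 :=
      toTorus_injective σ (by rw [h1, toTorus_single, chi])
    rw [h2, monoVal]
  · rintro rfl
    refine ⟨C.frame D, _, C.isFrame_frame D, ?_, rfl⟩
    rw [toTorus_single]
    exact chi_mul_chi_neg _

end ChartData

/-! ### The fibres of the family on a chart -/

lemma divX_nonneg {r a : ℕ} (ha : 0 < a) (har : a < r) (hc : Nat.Coprime a r) (i : ZMod r)
    (ρ : Ray r) : 0 ≤ divX r a i ρ := by
  rw [divX_eq ha har hc]; exact xDiv_nonneg _ _ _ _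

lemma divY_nonneg {r a : ℕ} (i : ZMod r) (ρ : Ray r) : 0 ≤ divY r a i ρ := by
  rw [divY_eq]; exact yDiv_nonneg _ _ _ _

lemma divZ_nonneg {r a : ℕ} (i : ZMod r) (ρ : Ray r) : 0 ≤ divZ r a i ρ := by
  rw [divZ_eq]; exact zDiv_nonneg _ _ _ _

lemma yDiv_add_zDiv (r a l : ℕ) (o : Option ℕ) :
    yDiv r a l o + zDiv r a l o = if o = none then 0 else 1 := by
  cases o with
  | none => rfl
  | some k => simp [yDiv, zDiv]

lemma divY_add_divZ {r a : ℕ} (i : ZMod r) (ρ : Ray r) :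
    divY r a i ρ + divZ r a (i + a) ρ = if ρ.label = none then 0 else 1 := by
  rw [divY_eq, divZ_eq, yDiv_add_zDiv]

namespace ChartData

variable {r a : ℕ} {σ : PointedCone ℝ Vec} (C : ChartData r a σ)

/-- The value of the natural section of `𝒪(D)`, for effective `D`, in the monomial frame. -/
noncomputable def secVal (u : Pt r a σ) (D : Divisor r) : ℂ :=
  ∏ j, C.coord u j ^ (D (C.ray j)).toNat

lemma isSectionValue_iff_secVal (u : Pt r a σ) {D : Divisor r} (hD : ∀ ρ, 0 ≤ D ρ) (c : ℂ) :
    IsSectionValue r a u D c ↔ c = C.secVal u D := by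
  rw [C.isSectionValue_iff u hD, C.monoVal_frame u hD, secVal]

lemma secVal_add (u : Pt r a σ) {D D' : Divisor r} (hD : ∀ ρ, 0 ≤ D ρ) (hD' : ∀ ρ, 0 ≤ D' ρ) :
    C.secVal u (D + D') = C.secVal u D * C.secVal u D' := by
  simp only [secVal, ← Finset.prod_mul_distrib, ← pow_add, Pi.add_apply,
    Int.toNat_add (hD _) (hD' _)]

lemma secVal_eq_one (u : Pt r a σ) {D : Divisor r} (hD : ∀ j, D (C.ray j) = 0) :
    C.secVal u D = 1 := by
  simp [secVal, hD]

lemma secVal_eq_coord (u : Pt r a σ) {D : Divisor r} {j : Fin 3}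
    (hD : ∀ i, D (C.ray i) = if i = j then 1 else 0) : C.secVal u D = C.coord u j := by
  rw [secVal, Finset.prod_eq_single j]
  · simp [hD]
  · intro i _ hi
    simp [hD, hi]
  · simp

lemma secVal_eq_zero_iff (u : Pt r a σ) (D : Divisor r) :
    C.secVal u D = 0 ↔ ∃ j, C.coord u j = 0 ∧ 0 < D (C.ray j) := by
  simp only [secVal, Finset.prod_eq_zero_iff, Finset.mem_univ, true_and,
    pow_eq_zero_iff', ne_eq, Int.toNat_eq_zero, not_le]

/-- The representation at a point of a chart. -/
noncomputable def fibre (ha : 0 < a) (u : Pt r a σ) : McKayRep r a where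
  x i := C.secVal u (divX r a i)
  y i := C.secVal u (divY r a i)
  z i := C.secVal u (divZ r a i)
  comm_xy i := by
    have hX := divX_nonneg ha C.lt C.coprime
    rw [← C.secVal_add u (divY_nonneg _) (hX _), ← C.secVal_add u (hX _) (divY_nonneg _)]
    congr 1
    funext ρ
    have h1 := congrFun (divX_rec r a C.lt C.coprime (i + a)) ρ
    have h2 := divY_add_divZ (a := a) (i + 1) ρ
    have h3 := divY_add_divZ (a := a) i ρ
    rw [add_sub_cancel_right] at h1
    rw [show i + 1 + (a : ZMod r) = i + a + 1 by ring] at h2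
    simp only [Pi.add_apply] at h1 ⊢
    linarith
  comm_xz i := by
    have hX := divX_nonneg ha C.lt C.coprime
    rw [← C.secVal_add u (divZ_nonneg _) (hX _), ← C.secVal_add u (hX _) (divZ_nonneg _),
      add_comm, divX_rec r a C.lt C.coprime, add_comm]
  comm_yz i := by
    rw [← C.secVal_add u (divY_nonneg _) (divZ_nonneg _),
      ← C.secVal_add u (divZ_nonneg _) (divY_nonneg _)]
    congr 1
    funext ρ
    have h2 := divY_add_divZ (a := a) (i - (a : ZMod r)) ρ
    have h3 := divY_add_divZ (a := a) i ρ
    rw [sub_add_cancel] at h2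
    simp only [Pi.add_apply]
    linarith

end ChartData

lemma isFibreInChart_iff {r a : ℕ} (ha : 0 < a) (u : ChartPoint r a)
    (C : ChartData r a (u.1 : PointedCone ℝ Vec)) (V : McKayRep r a) :
    IsFibreInChart u V ↔ ∀ i, V.x i = C.secVal u.2 (divX r a i) ∧
      V.y i = C.secVal u.2 (divY r a i) ∧ V.z i = C.secVal u.2 (divZ r a i) := by
  unfold IsFibreInChart
  refine forall_congr' fun i => ?_
  rw [C.isSectionValue_iff_secVal u.2 (divX_nonneg ha C.lt C.coprime i),
    C.isSectionValue_iff_secVal u.2 (divY_nonneg i),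
    C.isSectionValue_iff_secVal u.2 (divZ_nonneg i)]

lemma exists_isFibreInChart {r a : ℕ} (ha : 0 < a) (har : a < r) (hc : Nat.Coprime a r)
    (u : ChartPoint r a) : ∃ V : McKayRep r a, IsFibreInChart u V := by
  obtain ⟨C⟩ := nonempty_chartData har hc u.1.2
  exact ⟨C.fibre ha u.2, (isFibreInChart_iff ha u C _).2 fun i => ⟨rfl, rfl, rfl⟩⟩

namespace McKayRep

variable {r a : ℕ}

lemma Iso.symm {V W : McKayRep r a} (h : V.Iso W) : W.Iso V := by
  obtain ⟨g, hg⟩ := h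
  refine ⟨fun i => (g i)⁻¹, fun i => ?_⟩
  obtain ⟨hx, hy, hz⟩ := hg i
  have hne : ∀ i, (g i : ℂ) ≠ 0 := fun i => (g i).ne_zero
  rw [hx, hy, hz]
  simp only [inv_inv, Units.val_inv_eq_inv_val]
  refine ⟨?_, ?_, ?_⟩
  · have := hne i; have := hne (i + 1); field_simp
  · have := hne i; have := hne (i + a); field_simp
  · have := hne i; have := hne (i - a); field_simp

lemma Iso.trans {U V W : McKayRep r a} (h : U.Iso V) (h' : V.Iso W) : U.Iso W := by
  obtain ⟨g, hg⟩ := h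
  obtain ⟨g', hg'⟩ := h'
  refine ⟨fun i => g' i * g i, fun i => ?_⟩
  obtain ⟨hx, hy, hz⟩ := hg i
  obtain ⟨hx', hy', hz'⟩ := hg' i
  rw [hx', hy', hz', hx, hy, hz]
  simp only [Units.val_mul, mul_inv]
  refine ⟨by ring, by ring, by ring⟩

end McKayRep

/-! ### Independence of the chart -/

/-- The divisor `X_0 + ⋯ + X_{l-1}` of the path `0 → 1 → ⋯ → l`. -/
def xSum (r a l : ℕ) (ρ : Ray r) : ℤ := ∑ n ∈ Finset.range l, xDiv r a n ρ.label

lemma sum_xCoef {r a k : ℕ} {t : ℕ → ℝ}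
    (ht : ∀ l < r, (xCoef r a l k : ℝ) = alpha r a k / r + t l - t (next r l)) :
    ∀ l < r, ∑ n ∈ Finset.range l, (xCoef r a n k : ℝ) = l * (alpha r a k / r) + t 0 - t l := by
  intro l
  induction l with
  | zero => simp
  | succ l ih =>
    intro hl
    rw [Finset.sum_range_succ, ih (by omega), ht l (by omega), next, if_pos hl]
    push_cast
    ring

/-- `X_l` is linearly equivalent to the difference of the divisors `xSum` at its two ends. -/
lemma xDiv_eq {r a l : ℕ} (har : a < r) (hc : Nat.Coprime a r) (hl : l < r) :
    ∃ m : latticeM r a, ∀ ρ : Ray r, (xDiv r a l ρ.label : ℝ) =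
      xSum r a (next r l) ρ - xSum r a l ρ + pairing m (ρ.gen r a) := by
  have hr : (r : ℝ) ≠ 0 := by exact_mod_cast (show r ≠ 0 by omega)
  rcases (show l + 1 < r ∨ l + 1 = r by omega) with h | h
  · refine ⟨0, fun ρ => ?_⟩
    rw [next, if_pos h, xSum, xSum, Finset.sum_range_succ]
    simp [pairing]
  · refine ⟨⟨![r, 0, 0], (mem_latticeM_iff (by omega) _).2 (by simp)⟩, fun ρ => ?_⟩
    rw [next, if_neg (by omega), Ray.gen_eq]
    cases ρ with
    | e₁ =>
      simp [xSum, Ray.label, xDiv, pairing_eq, rayVec, e₁]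
      rw [← h]; push_cast; ring
    | p k =>
      obtain ⟨t, ht⟩ := exists_potential har hc k (by omega)
      have h1 := sum_xCoef (fun l hl => (ht l hl).2) l hl
      have h2 := (ht l hl).2
      rw [next, if_neg (by omega)] at h2
      have h3 : (r : ℝ) = l + 1 := by rw [← h]; push_cast; ring
      simp only [xSum, Ray.label, xDiv, pairing_eq, rayVec, p_apply_zero]
      simp
      rw [h1, h2]
      have h4 : (r : ℝ) * (alpha r a k / r) = (l + 1) * (alpha r a k / r) := by rw [← h3]
      linear_combination -h4

/-- `Z_l` is linearly equivalent to the difference of the divisors `xSum` at its two ends. -/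
lemma zDiv_eq {r a l : ℕ} (har : a < r) (hc : Nat.Coprime a r) (hl : l < r) :
    ∃ m : latticeM r a, ∀ ρ : Ray r, (zDiv r a l ρ.label : ℝ) =
      xSum r a (back r a l) ρ - xSum r a l ρ + pairing m (ρ.gen r a) := by
  have hr : (r : ℝ) ≠ 0 := by exact_mod_cast (show r ≠ 0 by omega)
  -- the monomial is `x ^ (l - back r a l) * z`, with exponent of `x` equal to `a` or `a - r`
  refine ⟨⟨![(l : ℤ) - back r a l, 0, 1], (mem_latticeM_iff (by omega) _).2 ?_⟩, fun ρ => ?_⟩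
  · simp only [Matrix.cons_val_zero, Matrix.cons_val_one, Matrix.cons_val]
    unfold back
    split_ifs with h
    · exact ⟨1, by push_cast [h]; ring⟩
    · refine ⟨0, ?_⟩
      have : ((l + r - a : ℕ) : ℤ) = l + r - a := by omega
      rw [this]; ring
  · rw [Ray.gen_eq]
    cases ρ with
    | e₁ =>
      simp [xSum, Ray.label, xDiv, zDiv, pairing_eq, rayVec, e₁]
    | p k =>
      obtain ⟨t, ht⟩ := exists_potential har hc k (by omega)
      have h1 := sum_xCoef (fun l hl => (ht l hl).2) l hl
      have h1' := sum_xCoef (fun l hl => (ht l hl).2) _ (back_lt har.le hl)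
      have h2 := (ht l hl).1
      simp only [xSum, Ray.label, xDiv, zDiv, pairing_eq, rayVec, p_apply_zero, p_apply_two]
      simp
      rw [h1, h1', h2]
      ring

section Glue

variable {r a : ℕ} {σ τ : PointedCone ℝ Vec} (C : ChartData r a σ) (C' : ChartData r a τ)

lemma ChartData.pairing_frame_eq (D : Divisor r) {v : Vec} (hσ : v ∈ σ) (hτ : v ∈ τ) :
    pairing (C.frame D) v = pairing (C'.frame D) v := by
  obtain ⟨c, hc, rfl⟩ := (C.mem_iff v).1 hσ
  obtain ⟨c', hc', he⟩ := (C'.mem_iff _).1 hτ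
  conv_rhs => rw [he]
  simp only [pairing_sum_smul, ChartData.pairing_frame]
  have h := Chart.piecewise_linear C.lt C.coprime _ _ C.chart C'.chart c c' hc hc'
    (by simpa only [Ray.gen_eq] using he)
    (Function.extend Ray.label (fun ρ => (D ρ : ℝ)) 0)
  simpa only [(Ray.label_injective r).extend_apply] using h

lemma ChartData.frame_sub_mem (D : Divisor r) :
    C'.frame D - C.frame D ∈ dualMonoid r a (σ ⊓ τ) := by
  intro v hv
  have h := C.pairing_frame_eq C' D hv.1 hv.2
  rw [AddSubgroup.coe_sub, sub_eq_add_neg, pairing_add, pairing_neg, h]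
  linarith

/-- The transition function of `𝒪(D)` from one chart to another, at a point of their intersection,
in the monomial frames. -/
noncomputable def transition (w : Pt r a (σ ⊓ τ)) : Multiplicative (Divisor r) →* ℂˣ :=
  MonoidHom.toHomUnits
    { toFun := fun D => monoVal w ⟨C'.frame D.toAdd - C.frame D.toAdd, C.frame_sub_mem C' _⟩
      map_one' := by
        have : (⟨C'.frame (0 : Divisor r) - C.frame 0, C.frame_sub_mem C' _⟩ :
            dualMonoid r a (σ ⊓ τ)) = 0 :=
          Subtype.ext (by simp [ChartData.frame_zero])
        exact (congrArg (monoVal w) this).trans (monoVal_zero w)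
      map_mul' := fun D D' => by
        rw [← monoVal_add]
        congr 1
        refine Subtype.ext ?_
        simp only [toAdd_mul, ChartData.frame_add, AddSubmonoid.coe_add]
        abel }

lemma coe_transition (w : Pt r a (σ ⊓ τ)) (D : Divisor r) :
    (transition C C' w (.ofAdd D) : ℂ) =
      monoVal w ⟨C'.frame D - C.frame D, C.frame_sub_mem C' D⟩ := rfl

lemma secVal_transition (w : Pt r a (σ ⊓ τ)) {D : Divisor r} (hD : ∀ ρ, 0 ≤ D ρ) :
    C'.secVal (chartMap r a inf_le_right w) D =
      transition C C' w (.ofAdd D) * C.secVal (chartMap r a inf_le_left w) D := by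
  rw [coe_transition, ChartData.secVal, ChartData.secVal, ← C.monoVal_frame _ hD,
    ← C'.monoVal_frame _ hD, monoVal_chartMap, monoVal_chartMap, ← monoVal_add]
  congr 1
  exact Subtype.ext (sub_add_cancel _ _).symm

lemma transition_eq_one (w : Pt r a (σ ⊓ τ)) {D : Divisor r} {m : latticeM r a}
    (h : ∀ ρ : Ray r, (D ρ : ℝ) = pairing m (ρ.gen r a)) :
    transition C C' w (.ofAdd D) = 1 := by
  refine Units.ext ?_
  rw [coe_transition]
  have : (⟨C'.frame D - C.frame D, C.frame_sub_mem C' D⟩ : dualMonoid r a (σ ⊓ τ)) = 0 :=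
    Subtype.ext (by simp [C.frame_eq h, C'.frame_eq h])
  rw [this, monoVal_zero]
  rfl

/-- Linearly equivalent divisors have the same transition functions. -/
lemma transition_eq (w : Pt r a (σ ⊓ τ)) {D E E' : Divisor r} {m : latticeM r a}
    (h : ∀ ρ : Ray r, (D ρ : ℝ) = E ρ - E' ρ + pairing m (ρ.gen r a)) :
    transition C C' w (.ofAdd D) =
      transition C C' w (.ofAdd E) * (transition C C' w (.ofAdd E'))⁻¹ := by
  have h1 := transition_eq_one C C' w (D := D - E + E') (m := m) (fun ρ => by
    simp only [Pi.add_apply, Pi.sub_apply]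
    push_cast
    rw [h]
    ring)
  rw [ofAdd_add, ofAdd_sub, map_mul, map_div] at h1
  rw [eq_mul_inv_iff_mul_eq, ← mul_right_inj (transition C C' w (.ofAdd E))⁻¹, inv_mul_cancel,
    ← h1, div_eq_mul_inv]
  exact (mul_comm _ _).trans (mul_right_comm _ _ _)

end Glue

lemma iso_of_glued {r a : ℕ} (ha : 0 < a) (har : a < r) (hc : Nat.Coprime a r)
    {u u' : ChartPoint r a} (h : Glued r a u u') {V W : McKayRep r a} (hV : IsFibreInChart u V)
    (hW : IsFibreInChart u' W) : V.Iso W := by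
  have : NeZero r := ⟨by omega⟩
  obtain ⟨w, hw, hw'⟩ := h
  obtain ⟨C⟩ := nonempty_chartData har hc u.1.2
  obtain ⟨C'⟩ := nonempty_chartData har hc u'.1.2
  rw [isFibreInChart_iff ha u C] at hV
  rw [isFibreInChart_iff ha u' C'] at hW
  rw [← hw] at hV
  rw [← hw'] at hW
  have hr : 1 < r := by omega
  refine ⟨fun i => transition C C' w (.ofAdd (xSum r a i.val)), fun i => ⟨?_, ?_, ?_⟩⟩
  · rw [(hW i).1, (hV i).1, secVal_transition C C' w (divX_nonneg ha har hc i)]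
    obtain ⟨m, hm⟩ := xDiv_eq har hc (ZMod.val_lt i)
    rw [transition_eq C C' w (fun ρ => by rw [divX_eq ha har hc]; exact hm ρ)]
    simp only [val_add_one hr]
    push_cast
    ring
  · rw [(hW i).2.1, (hV i).2.1, secVal_transition C C' w (divY_nonneg i)]
    obtain ⟨m, hm⟩ := zDiv_eq har hc (ZMod.val_lt (i + (a : ZMod r)))
    have hb : back r a (i + a).val = i.val := by
      rw [← val_sub_natCast har, add_sub_cancel_right]
    rw [hb] at hm
    have hyz : (![0, 1, 1] : Fin 3 → ℤ) ∈ latticeM r a :=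
      (mem_latticeM_iff (by omega) _).2 (by simp)
    have hd : ∀ ρ : Ray r, (divY r a i ρ : ℝ) = xSum r a (i + a).val ρ - xSum r a i.val ρ
        + pairing ((⟨_, hyz⟩ - m : latticeM r a) : Fin 3 → ℤ) (ρ.gen r a) := by
      intro ρ
      have h1 : (divY r a i ρ : ℝ) + divZ r a (i + a) ρ = pairing ![0, 1, 1] (ρ.gen r a) := by
        rw [← Int.cast_add, divY_add_divZ, pairing_eq, Ray.gen_eq]
        cases ρ with
        | e₁ => simp [Ray.label, rayVec, e₁]
        | p k =>
          have hr' : (r : ℝ) ≠ 0 := by exact_mod_cast (show r ≠ 0 by omega)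
          simp [Ray.label, rayVec, p_apply_one, p_apply_two]
          field_simp
          ring
      have h2 := hm ρ
      rw [divZ_eq] at h1
      rw [AddSubgroup.coe_sub, sub_eq_add_neg (_ : Fin 3 → ℤ), pairing_add, pairing_neg]
      linarith
    rw [transition_eq C C' w hd]
    push_cast
    ring
  · rw [(hW i).2.2, (hV i).2.2, secVal_transition C C' w (divZ_nonneg i)]
    obtain ⟨m, hm⟩ := zDiv_eq har hc (ZMod.val_lt i)
    rw [transition_eq C C' w (fun ρ => by rw [divZ_eq]; exact hm ρ)]
    simp only [val_sub_natCast har]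
    push_cast
    ring

lemma iso_of_isFibre {r a : ℕ} (ha : 0 < a) (har : a < r) (hc : Nat.Coprime a r)
    {s : Resolution r a} {V W : McKayRep r a} (hV : IsFibre s V) (hW : IsFibre s W) :
    V.Iso W := by
  obtain ⟨u, hu, hV⟩ := hV
  obtain ⟨u', hu', hW⟩ := hW
  have h := Quot.eqvGen_exact (hu.trans hu'.symm)
  clear hu hu'
  have key : ∀ V W : McKayRep r a, IsFibreInChart u V → IsFibreInChart u' W → V.Iso W := by
    clear hV hW
    induction h with
    | rel _ _ h => exact fun V W hV hW => iso_of_glued ha har hc h hV hW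
    | refl u =>
      intro V W hV hW
      obtain ⟨C⟩ := nonempty_chartData har hc u.1.2
      rw [isFibreInChart_iff ha u C] at hV hW
      refine ⟨fun _ => 1, fun i => ?_⟩
      simp [hV i, hW i]
    | symm _ _ _ ih => exact fun V W hV hW => (ih W V hW hV).symm
    | trans _ u _ _ _ ih ih' =>
      intro V W hV hW
      obtain ⟨U, hU⟩ := exists_isFibreInChart ha har hc u
      exact (ih V U hV hU).trans (ih' U W hU hW)
  exact key V W hV hW

/-! ### Points with isomorphic fibres -/

/-- Two points of one chart whose fibres are isomorphic are equal: an isomorphism is a constant,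
because the arrows which are invertible on the chart connect the quiver, and the coordinates are
values of arrows. -/
lemma eq_of_iso_of_chart {r a : ℕ} (ha : 0 < a) (har : a < r) (hc : Nat.Coprime a r)
    {σ : maxCones r a} {u u' : Pt r a (σ : PointedCone ℝ Vec)} {V W : McKayRep r a}
    (hV : IsFibreInChart ⟨σ, u⟩ V) (hW : IsFibreInChart ⟨σ, u'⟩ W) (h : V.Iso W) : u = u' := by
  have : NeZero r := ⟨by omega⟩
  obtain ⟨C⟩ := nonempty_chartData har hc σ.2
  rw [isFibreInChart_iff ha _ C] at hV hW
  obtain ⟨g, hg⟩ := h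
  have hval : ∀ l < r, (l : ZMod r).val = l := fun l hl => ZMod.val_cast_of_lt hl
  have hback : ∀ l < r, ((back r a l : ℕ) : ZMod r) = (l : ZMod r) - a := fun l hl => by
    rw [← hval l hl, ← val_sub_natCast har, ZMod.natCast_zmod_val, hval l hl]
  have hnext : ∀ l < r, ((next r l : ℕ) : ZMod r) = (l : ZMod r) + 1 := fun l hl => by
    rw [← hval l hl, ← val_add_one (by omega), ZMod.natCast_zmod_val, hval l hl]
  have hX : ∀ l < r, ∀ ρ : Ray r, divX r a (l : ZMod r) ρ = xDiv r a l ρ.label := fun l hl ρ => by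
    rw [divX_eq ha har hc, hval l hl]
  have hY : ∀ l < r, ∀ ρ : Ray r, divY r a ((l : ZMod r) - a) ρ = yDiv r a l ρ.label :=
    fun l hl ρ => by rw [divY_eq, sub_add_cancel, hval l hl]
  have hZ : ∀ l < r, ∀ ρ : Ray r, divZ r a (l : ZMod r) ρ = zDiv r a l ρ.label := fun l hl ρ => by
    rw [divZ_eq, hval l hl]
  have hunit : ∀ α β : ℂˣ, (1 : ℂ) = α * 1 * (β⁻¹ : ℂˣ) → α = β := by
    intro α β h
    rw [mul_one, ← Units.val_mul, ← Units.val_one, Units.val_inj] at h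
    exact (mul_inv_eq_one.1 h.symm)
  have hconst : ∀ i, g i = g 0 := by
    intro i
    have key := C.chart.connected (fun l => g (l : ZMod r)) ?_ ?_ ?_ i.val (ZMod.val_lt i)
    · simpa using key
    · intro l hl h0
      have h1 := (hg l).2.2
      rw [(hV l).2.2, (hW l).2.2, C.secVal_eq_one _ (fun j => by rw [hZ l hl]; exact h0 j),
        C.secVal_eq_one _ (fun j => by rw [hZ l hl]; exact h0 j)] at h1
      simp only [hback l hl]
      exact hunit _ _ h1
    · intro l hl h0
      have h1 := (hg ((l : ZMod r) - a)).2.1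
      rw [(hV _).2.1, (hW _).2.1, C.secVal_eq_one _ (fun j => by rw [hY l hl]; exact h0 j),
        C.secVal_eq_one _ (fun j => by rw [hY l hl]; exact h0 j), sub_add_cancel] at h1
      simp only [hback l hl]
      exact (hunit _ _ h1).symm
    · intro l hl h0
      have h1 := (hg l).1
      rw [(hV l).1, (hW l).1, C.secVal_eq_one _ (fun j => by rw [hX l hl]; exact h0 j),
        C.secVal_eq_one _ (fun j => by rw [hX l hl]; exact h0 j)] at h1
      simp only [hnext l hl]
      exact hunit _ _ h1
  have hcancel : ∀ z : ℂ, (g 0 : ℂ) * z * ((g 0)⁻¹ : ℂˣ) = z := fun z => by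
    rw [mul_comm, ← mul_assoc, Units.inv_mul, one_mul]
  refine C.ext_coord fun j => ?_
  obtain ⟨l, hl, h | h | h⟩ := C.chart.exists_arrow j
  · have h1 := (hg l).1
    rw [(hV l).1, (hW l).1, hconst, hconst l, hcancel,
      C.secVal_eq_coord u (fun i => by rw [hX l hl]; exact h i),
      C.secVal_eq_coord u' (fun i => by rw [hX l hl]; exact h i)] at h1
    exact h1.symm
  · have h1 := (hg ((l : ZMod r) - a)).2.1
    rw [(hV _).2.1, (hW _).2.1, hconst, hconst ((l : ZMod r) - a), hcancel,
      C.secVal_eq_coord u (fun i => by rw [hY l hl]; exact h i),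
      C.secVal_eq_coord u' (fun i => by rw [hY l hl]; exact h i)] at h1
    exact h1.symm
  · have h1 := (hg l).2.2
    rw [(hV l).2.2, (hW l).2.2, hconst, hconst l, hcancel,
      C.secVal_eq_coord u (fun i => by rw [hZ l hl]; exact h i),
      C.secVal_eq_coord u' (fun i => by rw [hZ l hl]; exact h i)] at h1
    exact h1.symm

/-- Let `K` and `K'` be sets of edges of two maximal cones, such that the same arrows vanish along
some divisor of `K` and along some divisor of `K'`.  Then the edges in `K` are edges of the second
cone: the arrows `y` and `z` determine the least and the greatest of the `p_k` in `K`, the arrow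
`x_0` shows whether `e₁` is in `K`, and a third element of `K` is seen by an arrow `x` and
determined by the other two. -/
lemma Chart.subset_of_vanishing {r a : ℕ} {s s' : Fin 3 → Option ℕ} (hs : Chart r a s)
    (hs' : Chart r a s') {K K' : Set (Option ℕ)} (hK : K ⊆ Set.range s) (hK' : K' ⊆ Set.range s')
    (hx : ∀ l < r, (∃ o ∈ K, 0 < xDiv r a l o) ↔ ∃ o ∈ K', 0 < xDiv r a l o)
    (hy : ∀ l < r, (∃ o ∈ K, 0 < yDiv r a l o) ↔ ∃ o ∈ K', 0 < yDiv r a l o)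
    (hz : ∀ l < r, (∃ o ∈ K, 0 < zDiv r a l o) ↔ ∃ o ∈ K', 0 < zDiv r a l o) :
    K ⊆ Set.range s' := by
  have har := hs.lt
  have hc := hs.coprime
  have hle : ∀ k, some k ∈ K → k ≤ r := fun k hk => by
    obtain ⟨j, hj⟩ := hK hk
    exact hs.le j hj
  have hle' : ∀ k, some k ∈ K' → k ≤ r := fun k hk => by
    obtain ⟨j, hj⟩ := hK' hk
    exact hs'.le j hj
  have hnone : none ∈ K ↔ none ∈ K' := by
    have h0 : ∀ L : Set (Option ℕ), (∀ k, some k ∈ L → k ≤ r) →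
        ((∃ o ∈ L, 0 < xDiv r a 0 o) ↔ none ∈ L) := by
      intro L hL
      constructor
      · rintro ⟨o, ho, hpos⟩
        cases o with
        | none => exact ho
        | some k => exact absurd hpos (by simp [xDiv, xCoef_zero_left har hc k (hL k ho)])
      · exact fun h => ⟨none, h, by simp [xDiv]⟩
    rw [← h0 K hle, ← h0 K' hle']
    exact hx 0 (by omega)
  have hlow : ∀ t < r, (∃ k, some k ∈ K ∧ k ≤ t) ↔ ∃ k, some k ∈ K' ∧ k ≤ t := by
    intro t ht
    obtain ⟨l, hl, rfl⟩ := tau_surjective har hc t ht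
    have h0 : ∀ L : Set (Option ℕ), (∃ o ∈ L, 0 < yDiv r a l o) ↔
        ∃ k, some k ∈ L ∧ k ≤ tau r a l := by
      intro L
      constructor
      · rintro ⟨o, ho, hpos⟩
        cases o with
        | none => exact absurd hpos (by simp [yDiv])
        | some k =>
          refine ⟨k, ho, ?_⟩
          by_contra hcon
          exact absurd hpos (by simp [yDiv, zCoef, not_le.1 hcon])
      · rintro ⟨k, hk, hkt⟩
        exact ⟨some k, hk, by simp [yDiv, zCoef, not_lt.2 hkt]⟩
    rw [← h0, ← h0]
    exact hy l hl
  have hhigh : ∀ t < r, (∃ k, some k ∈ K ∧ t < k) ↔ ∃ k, some k ∈ K' ∧ t < k := by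
    intro t ht
    obtain ⟨l, hl, rfl⟩ := tau_surjective har hc t ht
    have h0 : ∀ L : Set (Option ℕ), (∃ o ∈ L, 0 < zDiv r a l o) ↔
        ∃ k, some k ∈ L ∧ tau r a l < k := by
      intro L
      constructor
      · rintro ⟨o, ho, hpos⟩
        cases o with
        | none => exact absurd hpos (by simp [zDiv])
        | some k =>
          refine ⟨k, ho, ?_⟩
          by_contra hcon
          exact absurd hpos (by simp [zDiv, zCoef, hcon])
      · rintro ⟨k, hk, hkt⟩
        exact ⟨some k, hk, by simp [zDiv, zCoef, hkt]⟩
    rw [← h0, ← h0]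
    exact hz l hl
  have hmin : ∀ k, some k ∈ K → k < r → (∀ k', some k' ∈ K → k ≤ k') → some k ∈ K' := by
    intro k hk hkr hmin
    obtain ⟨k1, hk1, hle1⟩ := (hlow k hkr).1 ⟨k, hk, le_rfl⟩
    obtain ⟨k2, hk2, hle2⟩ := (hlow k1 (by omega)).2 ⟨k1, hk1, le_rfl⟩
    have := hmin k2 hk2
    obtain rfl : k1 = k := by omega
    exact hk1
  have hmax : ∀ k, some k ∈ K → 0 < k → (∀ k', some k' ∈ K → k' ≤ k) → some k ∈ K' := by
    intro k hk hk0 hmax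
    have hkr := hle k hk
    obtain ⟨k1, hk1, hle1⟩ := (hhigh (k - 1) (by omega)).1 ⟨k, hk, by omega⟩
    rcases (show k1 = k ∨ k < k1 by omega) with rfl | h
    · exact hk1
    · have := hle' k1 hk1
      obtain ⟨k2, hk2, hle2⟩ := (hhigh k (by omega)).2 ⟨k1, hk1, h⟩
      have := hmax k2 hk2
      omega
  rintro (_ | k) hk
  · exact hK' (hnone.1 hk)
  · rcases hs.shape with ⟨k0, hk0, rfl⟩ | ⟨i, j, k0, hij, hjk, hk0, rfl⟩
    · have hmem : ∀ k', some k' ∈ K → k' = k0 ∨ k' = k0 + 1 := by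
        intro k' hk'
        obtain ⟨j, hj⟩ := hK hk'
        fin_cases j <;> simp at hj <;> omega
      rcases hmem k hk with rfl | rfl
      · exact hK' (hmin _ hk (by omega) fun k' hk' => by have := hmem k' hk'; omega)
      · exact hK' (hmax _ hk (by omega) fun k' hk' => by have := hmem k' hk'; omega)
    · have hmem : ∀ k', some k' ∈ K → k' = i ∨ k' = j ∨ k' = k0 := by
        intro k' hk'
        obtain ⟨j', hj'⟩ := hK hk'
        fin_cases j' <;> simp at hj' <;> omega
      rcases hmem k hk with rfl | rfl | rfl
      · exact hK' (hmin _ hk (by omega) fun k' hk' => by have := hmem k' hk'; omega)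
      · by_cases hi : some i ∈ K
        · by_cases hk0' : some k0 ∈ K
          · have hi' := hmin i hi (by omega) fun k' hk' => by have := hmem k' hk'; omega
            have hk' := hmax k0 hk0' (by omega) fun k' hk' => by have := hmem k' hk'; omega
            by_contra hcon
            have hnone' : none ∉ K' := fun h => by
              obtain ⟨j', hj'⟩ := hK (hnone.2 h)
              fin_cases j' <;> simp at hj'
            -- an arrow which vanishes along `D_k`, but not along `D_i` and not along `D_{k0}`,
            -- gives another element of `K'`
            have hthird : ∃ o ∈ K', o ≠ some i ∧ o ≠ some k0 := by
              obtain ⟨l, hl, h⟩ := hs.exists_arrow 2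
              have aux : ∀ D : Option ℕ → ℤ,
                  (∀ m, D (![some i, some k0, some k] m) = if m = 2 then 1 else 0) →
                  ((∃ o ∈ K, 0 < D o) ↔ ∃ o ∈ K', 0 < D o) →
                  ∃ o ∈ K', o ≠ some i ∧ o ≠ some k0 := by
                intro D hD hiff
                have hD0 : D (some i) = 0 := hD 0
                have hD1 : D (some k0) = 0 := hD 1
                have hD2 : D (some k) = 1 := hD 2
                obtain ⟨o, ho, hpos⟩ := hiff.1 ⟨some k, hk, by rw [hD2]; exact one_pos⟩
                exact ⟨o, ho, fun h => by rw [h, hD0] at hpos; exact lt_irrefl _ hpos,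
                  fun h => by rw [h, hD1] at hpos; exact lt_irrefl _ hpos⟩
              rcases h with h | h | h
              · exact aux _ h (hx l hl)
              · exact aux _ h (hy l hl)
              · exact aux _ h (hz l hl)
            obtain ⟨_ | x, ho, hoi, hok⟩ := hthird
            · exact hnone' ho
            · have hxi : x ≠ i := fun h => hoi (by rw [h])
              have hxk : x ≠ k0 := fun h => hok (by rw [h])
              have hxr := hle' x ho
              have hix : i ≤ x := by
                by_contra hlt
                obtain ⟨k2, hk2, hle2⟩ := (hlow x (by omega)).2 ⟨x, ho, le_rfl⟩
                have := hmem k2 hk2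
                omega
              have hxk0 : x ≤ k0 := by
                by_contra hlt
                obtain ⟨k2, hk2, hle2⟩ := (hhigh k0 (by omega)).2 ⟨x, ho, by omega⟩
                have := hmem k2 hk2
                omega
              obtain ⟨m1, hm1⟩ := hK' hi'
              obtain ⟨m2, hm2⟩ := hK' ho
              obtain ⟨m3, hm3⟩ := hK' hk'
              rcases hs'.shape with ⟨k1, hk1, rfl⟩ | ⟨i1, j1, k1, hij1, hjk1, hk1, rfl⟩
              · fin_cases m1 <;> simp at hm1 <;> fin_cases m2 <;> simp at hm2 <;>
                  fin_cases m3 <;> simp at hm3 <;> omega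
              · have h3 : i1 = i ∧ j1 = x ∧ k1 = k0 := by
                  fin_cases m1 <;> simp at hm1 <;> fin_cases m2 <;> simp at hm2 <;>
                    fin_cases m3 <;> simp at hm3 <;> omega
                obtain ⟨rfl, rfl, rfl⟩ := h3
                exact hcon ⟨2, congrArg some
                  (Chart.middle_unique har hc _ _ _ _ (by omega) hs' hs)⟩
          · refine hK' (hmax _ hk (by omega) fun k' hk' => ?_)
            rcases hmem k' hk' with rfl | rfl | rfl
            · omega
            · omega
            · exact absurd hk' hk0'
        · refine hK' (hmin _ hk (by omega) fun k' hk' => ?_)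
          rcases hmem k' hk' with rfl | rfl | rfl
          · exact absurd hk' hi
          · omega
          · omega
      · exact hK' (hmax _ hk (by omega) fun k' hk' => by have := hmem k' hk'; omega)

/-- A point of `U_σ` whose vanishing coordinates all belong to rays of `τ` lies in `U_{σ ∩ τ}`. -/
lemma ChartData.exists_lift {r a : ℕ} {σ τ : PointedCone ℝ Vec} (C : ChartData r a σ)
    (u : Pt r a σ) (h : ∀ j, C.coord u j = 0 → (C.ray j).gen r a ∈ τ) :
    ∃ w : Pt r a (σ ⊓ τ), chartMap r a inf_le_left w = u := by
  have hzero : ∀ ρ : Ray r, order ρ (0 : latticeM r a) = 0 := fun ρ => by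
    have h1 := order_add C.lt C.coprime ρ 0 0
    rw [add_zero] at h1
    omega
  let f : Multiplicative (dualMonoid r a (σ ⊓ τ)) →* ℂ :=
    { toFun := fun m => ∏ j, C.coord u j ^ order (C.ray j) (m.toAdd : latticeM r a)
      map_one' := by
        simp [hzero]
      map_mul' := fun m n => by
        rw [← Finset.prod_mul_distrib]
        refine Finset.prod_congr rfl fun j _ => ?_
        rw [toAdd_mul, AddSubmonoid.coe_add, order_add C.lt C.coprime]
        refine zpow_add' ?_
        by_cases hj : C.coord u j = 0
        · have hmem : (C.ray j).gen r a ∈ σ ⊓ τ := ⟨C.gen_mem j, h j hj⟩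
          have h1 : 0 ≤ order (C.ray j) (m.toAdd : latticeM r a) :=
            Int.floor_nonneg.2 (m.toAdd.2 _ hmem)
          have h2 : 0 ≤ order (C.ray j) (n.toAdd : latticeM r a) :=
            Int.floor_nonneg.2 (n.toAdd.2 _ hmem)
          omega
        · exact Or.inl hj }
  refine ⟨AddMonoidAlgebra.lift ℂ ℂ _ f, pt_ext fun m => ?_⟩
  rw [monoVal_chartMap, C.monoVal_eq_prod, monoVal, AddMonoidAlgebra.lift_single, one_smul]
  change ∏ j, C.coord u j ^ order (C.ray j) (m : latticeM r a) = _
  refine Finset.prod_congr rfl fun j _ => ?_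
  have h1 : 0 ≤ order (C.ray j) (m : latticeM r a) := Int.floor_nonneg.2 (m.2 _ (C.gen_mem j))
  rw [← zpow_natCast, Int.toNat_of_nonneg h1]

lemma glued_of_iso {r a : ℕ} (ha : 0 < a) (har : a < r) (hc : Nat.Coprime a r)
    {u v : ChartPoint r a} {V W : McKayRep r a} (hV : IsFibreInChart u V)
    (hW : IsFibreInChart v W) (h : V.Iso W) : Glued r a u v := by
  have : NeZero r := ⟨by omega⟩
  obtain ⟨σ, u⟩ := u
  obtain ⟨τ, v⟩ := v
  obtain ⟨C⟩ := nonempty_chartData har hc σ.2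
  obtain ⟨C'⟩ := nonempty_chartData har hc τ.2
  have hV' := (isFibreInChart_iff ha _ C V).1 hV
  have hW' := (isFibreInChart_iff ha _ C' W).1 hW
  obtain ⟨g, hg⟩ := h
  -- the rays whose divisors contain the two points
  let K : Set (Option ℕ) := {o | ∃ j, C.coord u j = 0 ∧ (C.ray j).label = o}
  let K' : Set (Option ℕ) := {o | ∃ j, C'.coord v j = 0 ∧ (C'.ray j).label = o}
  have hvan : ∀ (D : Divisor r) (D₀ : Option ℕ → ℤ), (∀ ρ, D ρ = D₀ ρ.label) →
      (C'.secVal v D = 0 ↔ C.secVal u D = 0) →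
      ((∃ o ∈ K, 0 < D₀ o) ↔ ∃ o ∈ K', 0 < D₀ o) := by
    intro D D₀ hD hiff
    rw [C.secVal_eq_zero_iff, C'.secVal_eq_zero_iff] at hiff
    simp only [hD] at hiff
    constructor
    · rintro ⟨_, ⟨j, hj, rfl⟩, hpos⟩
      obtain ⟨i, hi, hpos'⟩ := hiff.2 ⟨j, hj, hpos⟩
      exact ⟨_, ⟨i, hi, rfl⟩, hpos'⟩
    · rintro ⟨_, ⟨j, hj, rfl⟩, hpos⟩
      obtain ⟨i, hi, hpos'⟩ := hiff.1 ⟨j, hj, hpos⟩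
      exact ⟨_, ⟨i, hi, rfl⟩, hpos'⟩
  have hunit : ∀ (α β : ℂˣ) (z : ℂ), (α : ℂ) * z * (β⁻¹ : ℂˣ) = 0 ↔ z = 0 := fun α β z => by
    simp
  have hsub : K ⊆ Set.range fun j => (C'.ray j).label := by
    refine C.chart.subset_of_vanishing C'.chart (K' := K') ?_ ?_ ?_ ?_ ?_
    · rintro _ ⟨j, -, rfl⟩; exact ⟨j, rfl⟩
    · rintro _ ⟨j, -, rfl⟩; exact ⟨j, rfl⟩
    · intro l hl
      refine hvan (divX r a (l : ZMod r)) _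
        (fun ρ => by rw [divX_eq ha har hc, ZMod.val_cast_of_lt hl]) ?_
      rw [← (hV' l).1, ← (hW' l).1, (hg l).1, hunit]
    · intro l hl
      refine hvan (divY r a ((l : ZMod r) - a)) _
        (fun ρ => by rw [divY_eq, sub_add_cancel, ZMod.val_cast_of_lt hl]) ?_
      rw [← (hV' _).2.1, ← (hW' _).2.1, (hg _).2.1, hunit]
    · intro l hl
      refine hvan (divZ r a (l : ZMod r)) _
        (fun ρ => by rw [divZ_eq, ZMod.val_cast_of_lt hl]) ?_
      rw [← (hV' l).2.2, ← (hW' l).2.2, (hg l).2.2, hunit]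
  obtain ⟨w, hw⟩ := C.exists_lift u (τ := τ) (fun j hj => by
    obtain ⟨i, hi⟩ := hsub ⟨j, hj, rfl⟩
    rw [← Ray.label_injective r hi]
    exact C'.gen_mem i)
  -- the second chart contains the first point too, and there points are told apart by their fibres
  let v' : ChartPoint r a := ⟨τ, chartMap r a inf_le_right w⟩
  have hglue : Glued r a ⟨σ, u⟩ v' := ⟨w, hw, rfl⟩
  obtain ⟨W', hW'⟩ := exists_isFibreInChart ha har hc v'
  have hiso : W'.Iso W := (iso_of_glued ha har hc hglue hV hW').symm.trans ⟨g, hg⟩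
  exact ⟨w, hw, eq_of_iso_of_chart ha har hc hW' hW hiso⟩

end Danilov

/-- At every closed point of the Danilov resolution the family has a representation as its fibre, in
each chart; it does not depend on the chart, up to isomorphism; and the representations at two
distinct closed points are not isomorphic. -/
theorem mainTheorem3 (r a : ℕ) (ha : 0 < a) (har : a < r) (hc : Nat.Coprime a r) :
    (∀ u : Danilov.ChartPoint r a, ∃ V : Danilov.McKayRep r a, Danilov.IsFibreInChart u V) ∧
    (∀ (s : Danilov.Resolution r a) (V W : Danilov.McKayRep r a),
      Danilov.IsFibre s V → Danilov.IsFibre s W → V.Iso W) ∧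
    (∀ s t : Danilov.Resolution r a, s ≠ t → ∀ V W : Danilov.McKayRep r a,
      Danilov.IsFibre s V → Danilov.IsFibre t W → ¬ V.Iso W) := by
  refine ⟨Danilov.exists_isFibreInChart ha har hc,
    fun s V W hV hW => Danilov.iso_of_isFibre ha har hc hV hW, ?_⟩
  rintro s t hst V W ⟨u, rfl, hV⟩ ⟨v, rfl, hW⟩ h
  exact hst (Quot.sound (Danilov.glued_of_iso ha har hc hV hW h))
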